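/- For $\theta\in\mathbb{R}$ let $R_\theta$ be the rotation of $\mathbb{R}^2$ of angle $\theta$, and for $v,v_*\in\mathbb{R}^2$ put $v'=v'(v,v_*,\theta)=\frac{v+v_*}{2}+R_\theta\frac{v-v_*}{2}$. Let $\gamma\in(-2,-1)$. Let $\beta$ be a nonnegative symmetric (even) measure on $[-\pi/2,\pi/2]\setminus\{0\}$ with total mass in $(0,\infty)$, such that $\beta((-\theta_0,\theta_0))=0$ for some $\theta_0\in(0,\pi/2)$. Let $r_0>0$ and let $f_0$ be the uniform probability distribution on the circle $\{v\in\mathbb{R}^2:|v|=r_0\}$. For Lipschitz $\varphi:\mathbb{R}^2\to\mathbb{R}$ put $$\mathcal{A}\varphi(v,v_*)=\mathbf{1}_{\{v\ne v_*\}}|v-v_*|^\gamma\int_{-\pi/2}^{\pi/2}\beta(d\theta)\,[\varphi(v')-\varphi(v)].$$ Then there exists a family $(f_t)_{t\ge 0}$ of probability measures on $\mathbb{R}^2$ which is a weak solution of the Boltzmann equation linearized around $f_0$, that is, for all globally Lipschitz $\varphi:\mathbb{R}^2\to\mathbb{R}$ and all $t\ge 0$, $$\int_{\mathbb{R}^2}f_t(dv)\,\varphi(v)=\int_{\mathbb{R}^2}f_0(dv)\,\varphi(v)+\int_0^t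 ds\int_{\mathbb{R}^2}f_s(dv)\int_{\mathbb{R}^2}f_0(dv_*)\,\mathcal{A}\varphi(v,v_*),$$ where all the integrals are well defined ($\varphi$ is $f_t$-integrable, $\mathcal{A}\varphi$ is $f_s\otimes f_0$-integrable for every $s\ge 0$, and the integrand in $s$ is integrable on $[0,t]$), and such that for almost every $t>0$ the measure $f_t$ has a density with respect to the Lebesgue measure on $\mathbb{R}^2$. -/

import Mathlib

open MeasureTheory Set

noncomputable section

namespace LinBoltzmann

/-- The Euclidean plane `ℝ²`. -/
abbrev Plane : Type := EuclideanSpace ℝ (Fin 2)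

/-- The rotation `R_θ` of angle `θ` of the plane. -/
def rot (θ : ℝ) (x : Plane) : Plane :=
  !₂[Real.cos θ * x 0 - Real.sin θ * x 1, Real.sin θ * x 0 + Real.cos θ * x 1]

/-- The post-collisional velocity `v' = (v + v_*) / 2 + R_θ ((v - v_*) / 2)`. -/
def postVel (v w : Plane) (θ : ℝ) : Plane :=
  (2⁻¹ : ℝ) • (v + w) + rot θ ((2⁻¹ : ℝ) • (v - w))

/-- The angular cross section `β` is an even nonnegative measure carried by
`[-π/2, π/2] \ {0}`, with total mass in `(0, ∞)`. -/
structure IsCrossSection (β : Measure ℝ) : Prop where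
  carrier : β (Icc (-(Real.pi / 2)) (Real.pi / 2) \ {0})ᶜ = 0
  even : β.map (fun θ => -θ) = β
  mass_pos : 0 < β univ
  mass_lt_top : β univ < ⊤

/-- `β` vanishes on a neighbourhood of `θ = 0`. -/
def VanishesNearZero (β : Measure ℝ) : Prop :=
  ∃ θ₀ ∈ Ioo 0 (Real.pi / 2), β (Ioo (-θ₀) θ₀) = 0

open Classical in
/-- The collision operator
`A φ (v, v_*) = 1_{v ≠ v_*} |v - v_*|^γ ∫_{[-π/2, π/2]} (φ(v') - φ(v)) β(dθ)`. -/
def collision (γ : ℝ) (β : Measure ℝ) (φ : Plane → ℝ) (v w : Plane) : ℝ :=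
  if v = w then 0
  else ‖v - w‖ ^ γ *
    ∫ θ in Icc (-(Real.pi / 2)) (Real.pi / 2), (φ (postVel v w θ) - φ v) ∂β

/-- The family `(f t)`, `t ≥ 0`, of probability measures is a weak solution of the Boltzmann
equation linearized around `f₀`: for every globally Lipschitz `φ` and every `t ≥ 0`, all the terms
of the weak equation make sense (as absolutely convergent integrals) and the equation holds.
Only the values of `f` at nonnegative times matter. -/
structure IsSolution (f₀ : Measure Plane) (γ : ℝ) (β : Measure ℝ) (f : ℝ → Measure Plane) :
    Prop where
  isProb : ∀ t, 0 ≤ t → IsProbabilityMeasure (f t)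
  integrable : ∀ φ : Plane → ℝ, (∃ K, LipschitzWith K φ) → ∀ t, 0 ≤ t → Integrable φ (f t)
  integrable_collision : ∀ φ : Plane → ℝ, (∃ K, LipschitzWith K φ) → ∀ s, 0 ≤ s →
    Integrable (fun p : Plane × Plane => collision γ β φ p.1 p.2) ((f s).prod f₀)
  integrable_time : ∀ φ : Plane → ℝ, (∃ K, LipschitzWith K φ) → ∀ t, 0 ≤ t →
    IntervalIntegrable (fun s => ∫ v, ∫ w, collision γ β φ v w ∂f₀ ∂(f s)) volume 0 t
  weak_eq : ∀ φ : Plane → ℝ, (∃ K, LipschitzWith K φ) → ∀ t, 0 ≤ t →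
    ∫ v, φ v ∂(f t) =
      ∫ v, φ v ∂f₀ + ∫ s in (0 : ℝ)..t, ∫ v, ∫ w, collision γ β φ v w ∂f₀ ∂(f s)

/-- The uniform probability distribution on the circle `{|v| = r}`: the image of the normalized
Lebesgue measure on `(-π, π]` under `α ↦ r (cos α, sin α)`. -/
def uniformCircle (r : ℝ) : Measure Plane :=
  ENNReal.ofReal (1 / (2 * Real.pi)) •
    (volume.restrict (Ioc (-Real.pi) Real.pi)).map
      (fun α : ℝ => (!₂[r * Real.cos α, r * Real.sin α] : Plane))

/-- `μ` has a density with respect to the Lebesgue measure on `ℝ²`. -/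
def HasLebesgueDensity (μ : Measure Plane) : Prop :=
  ∃ g : Plane → ENNReal, Measurable g ∧ μ = volume.withDensity g

end LinBoltzmann

end

/-!
The solution is the law of a jump process started from the uniform distribution `f₀` on the circle
`C` of radius `r`: from the velocity `v`, at rate `|v - v_*| ^ γ f₀(dv_*) β(dθ)`, jump to `v'`. On
`C` the total rate is infinite, since `γ < -1`, but a jump has length at most `|v - v_*|`, and
`|v - v_*| ^ (γ + 1)` is `f₀`-integrable, uniformly in `v`, since `γ + 1 > -1`. Hence the generator
maps Lipschitz functions to bounded continuous functions, and is the uniform limit of the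
generators in which the rate is frozen below a distance `δ` (`exists_jumpGen_bound`).

*Existence.* For the truncated rates an explicit Euler scheme produces probability measures; they
are rotationally symmetric and carried by a fixed ball, because collisions with `|θ| ≥ θ₀` contract
(`exists_stableBall`). By compactness the schemes converge, along an ultrafilter and at each time,
to a family `f t`. The increments of `∫ φ d(f t)` are then known to first order, locally uniformly
in time, and the weak equation follows from the fundamental theorem of calculus
(`exists_radial_solution`).

*Density off the circle.* A particle which is close to a compact set `K` disjoint from `C`, or which
jumps there, has `|v - v_*|` bounded below, so the weak equation extends to the indicator function
of `K`; as the loss term has a sign, `f t K = 0` as soon as collisions almost surely do not lead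
into `K` (`IsSolution.measure_eq_zero_of_isCompact`). This applies to `K = {0}`, and then to every
Lebesgue-null `K`: if `v` is rotationally symmetric and nonzero, then `|v'| ^ 2` is an affine
function of `sin a`, with `a` uniform, so that `|v'|` has a density, and by symmetry so does `v'`
(`ae_postVel_notMem_of_volume_eq_zero`).

*No time is spent on the circle.* Let `α = -(γ + 1)` and let `D` be the distance to `C`. Test the
equation with Lipschitz approximations of `min D 1 ^ α`. Off the circle the loss is at most
`D ^ α` times the collision rate, which is of order `D ^ (γ + 1) = D ^ (-α)`, hence bounded. On the
circle there is no loss, and the gain is at least of order `∫ a ^ γ * a ^ α da = ∫ da / a = ∞`. As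
the test functions are bounded by `1`, the time integral of `f t C` vanishes
(`IsSolution.ae_measure_circle_eq_zero`).
-/

namespace LinBoltzmann

open Filter Topology
open scoped ENNReal NNReal

/-! ### Rotations and collisions in the plane -/

lemma norm_sq_plane (x : Plane) : ‖x‖ ^ 2 = x 0 ^ 2 + x 1 ^ 2 := by
  rw [EuclideanSpace.norm_sq_eq, Fin.sum_univ_two, Real.norm_eq_abs, Real.norm_eq_abs, sq_abs,
    sq_abs]

@[simp] lemma rot_apply_zero (θ : ℝ) (x : Plane) :
    rot θ x 0 = Real.cos θ * x 0 - Real.sin θ * x 1 := rfl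

@[simp] lemma rot_apply_one (θ : ℝ) (x : Plane) :
    rot θ x 1 = Real.sin θ * x 0 + Real.cos θ * x 1 := rfl

lemma plane_ext {x y : Plane} (h0 : x 0 = y 0) (h1 : x 1 = y 1) : x = y := by
  ext i; fin_cases i
  · exact h0
  · exact h1

lemma norm_rot (θ : ℝ) (x : Plane) : ‖rot θ x‖ = ‖x‖ := by
  rw [← sq_eq_sq₀ (norm_nonneg _) (norm_nonneg _), norm_sq_plane, norm_sq_plane]
  simp only [rot_apply_zero, rot_apply_one]
  linear_combination (x 0 ^ 2 + x 1 ^ 2) * Real.sin_sq_add_cos_sq θ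

lemma rot_sub (θ : ℝ) (x y : Plane) : rot θ (x - y) = rot θ x - rot θ y := by
  apply plane_ext <;> simp <;> ring

lemma rot_rot (a b : ℝ) (x : Plane) : rot a (rot b x) = rot (a + b) x := by
  apply plane_ext <;> simp [Real.cos_add, Real.sin_add] <;> ring

lemma rot_zero (x : Plane) : rot 0 x = x := by
  apply plane_ext <;> simp

lemma continuous_rot_uncurry : Continuous fun p : ℝ × Plane => rot p.1 p.2 := by
  unfold rot
  refine (PiLp.continuous_toLp 2 (fun _ : Fin 2 => ℝ)).comp ?_
  refine continuous_pi fun i => ?_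
  fin_cases i
  · simp; fun_prop
  · simp; fun_prop

lemma continuous_rot (θ : ℝ) : Continuous (rot θ) := by
  have h : Continuous fun x : Plane => (θ, x) := Continuous.prodMk_right θ
  exact (continuous_rot_uncurry.comp h).congr fun x => rfl

lemma measurable_rot (θ : ℝ) : Measurable (rot θ) := (continuous_rot θ).measurable

/-- The rotation of angle `η` as a measurable equivalence. -/
noncomputable def rotEquiv (η : ℝ) : Plane ≃ᵐ Plane where
  toFun := rot η
  invFun := rot (-η)
  left_inv x := by simp [rot_rot, rot_zero]
  right_inv x := by simp [rot_rot, rot_zero]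
  measurable_toFun := measurable_rot η
  measurable_invFun := measurable_rot (-η)

lemma exists_eq_rot (v : Plane) : ∃ η, v = rot η !₂[‖v‖, 0] := by
  set z : ℂ := ⟨v 0, v 1⟩ with hz
  have hn : ‖z‖ = ‖v‖ := by
    rw [← sq_eq_sq₀ (norm_nonneg _) (norm_nonneg _), norm_sq_plane, ← Complex.normSq_eq_norm_sq,
      Complex.normSq_apply]
    ring
  refine ⟨z.arg, plane_ext ?_ ?_⟩
  · have := Complex.norm_mul_cos_arg z
    simp [← hn]; linarith
  · have := Complex.norm_mul_sin_arg z
    simp [← hn]; linarith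

lemma postVel_rot (η : ℝ) (v w : Plane) (θ : ℝ) :
    postVel (rot η v) (rot η w) θ = rot η (postVel v w θ) := by
  unfold postVel
  apply plane_ext <;> simp <;> ring

lemma continuous_postVel : Continuous fun p : Plane × (Plane × ℝ) => postVel p.1 p.2.1 p.2.2 := by
  unfold postVel
  have := continuous_rot_uncurry.comp
    (by fun_prop : Continuous fun p : Plane × (Plane × ℝ) =>
      (p.2.2, (2⁻¹ : ℝ) • (p.1 - p.2.1)))
  exact (by fun_prop : Continuous fun p : Plane × (Plane × ℝ) =>
    (2⁻¹ : ℝ) • (p.1 + p.2.1)).add this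

lemma postVel_self (v : Plane) (θ : ℝ) : postVel v v θ = v := by
  unfold postVel
  apply plane_ext <;> simp <;> ring

/-- The velocities `v`, `v_*` and `v'` lie on the circle of diameter `[v, v_*]`; in particular a
collision displaces `v` by at most `|v - v_*|`. -/
lemma norm_postVel_sub_le (v w : Plane) (θ : ℝ) : ‖postVel v w θ - v‖ ≤ ‖v - w‖ := by
  have h : postVel v w θ - v = rot θ ((2⁻¹ : ℝ) • (v - w)) - (2⁻¹ : ℝ) • (v - w) := by
    unfold postVel
    apply plane_ext <;> simp <;> ring
  rw [h]
  refine (norm_sub_le _ _).trans (le_of_eq ?_)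
  rw [norm_rot, norm_smul]; norm_num; ring

lemma norm_postVel_sub_right_le (v w : Plane) (θ : ℝ) : ‖postVel v w θ - w‖ ≤ ‖v - w‖ := by
  have h : postVel v w θ - w = rot θ ((2⁻¹ : ℝ) • (v - w)) + (2⁻¹ : ℝ) • (v - w) := by
    unfold postVel
    apply plane_ext <;> simp <;> ring
  rw [h]
  refine (norm_add_le _ _).trans (le_of_eq ?_)
  rw [norm_rot, norm_smul]; norm_num; ring

lemma postVel_sub_postVel_left (v₁ v₂ w : Plane) (θ : ℝ) :
    ‖postVel v₁ w θ - postVel v₂ w θ‖ ≤ ‖v₁ - v₂‖ := by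
  have h : postVel v₁ w θ - postVel v₂ w θ
      = rot θ ((2⁻¹ : ℝ) • (v₁ - v₂)) + (2⁻¹ : ℝ) • (v₁ - v₂) := by
    unfold postVel
    apply plane_ext <;> simp <;> ring
  rw [h]
  refine (norm_add_le _ _).trans (le_of_eq ?_)
  rw [norm_rot, norm_smul]; norm_num; ring

/-- `v'` is the sum of `(v + R_θ v) / 2`, of norm `|cos (θ / 2)| ‖v‖`, and of `(w - R_θ w) / 2`. -/
lemma norm_postVel_le (v w : Plane) (θ : ℝ) :
    ‖postVel v w θ‖ ≤ |Real.cos (θ / 2)| * ‖v‖ + ‖w‖ := by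
  have h : postVel v w θ = (2⁻¹ : ℝ) • (v + rot θ v) + (2⁻¹ : ℝ) • (w - rot θ w) := by
    unfold postVel
    apply plane_ext <;> simp <;> ring
  have h1 : ‖(2⁻¹ : ℝ) • (v + rot θ v)‖ = |Real.cos (θ / 2)| * ‖v‖ := by
    rw [← sq_eq_sq₀ (norm_nonneg _) (by positivity), mul_pow, sq_abs, norm_sq_plane, norm_sq_plane,
      Real.cos_sq, show 2 * (θ / 2) = θ by ring]
    simp
    linear_combination (1 / 4 * (v 0 ^ 2 + v 1 ^ 2)) * Real.sin_sq_add_cos_sq θ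
  rw [h]
  refine (norm_add_le _ _).trans ?_
  rw [h1]
  gcongr
  rw [norm_smul]
  have := norm_sub_le w (rot θ w)
  rw [norm_rot] at this
  norm_num; linarith

/-- With `v` on the first axis and `v_* = r (cos a, sin a)`, the speed after the collision is an
affine function of `sin a`. -/
lemma norm_sq_postVel_axis (ρ r a θ : ℝ) :
    ‖postVel !₂[ρ, 0] !₂[r * Real.cos a, r * Real.sin a] θ‖ ^ 2 =
      (ρ ^ 2 * (1 + Real.cos θ) / 2 + r ^ 2 * (1 - Real.cos θ) / 2)
        + ρ * r * Real.sin θ * Real.sin a := by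
  rw [norm_sq_plane]
  unfold postVel
  simp
  have h1 := Real.sin_sq_add_cos_sq θ
  have h2 := Real.sin_sq_add_cos_sq a
  have h1' : Real.sin θ ^ 2 = 1 - Real.cos θ ^ 2 := by linarith
  have h2' : Real.sin a ^ 2 = 1 - Real.cos a ^ 2 := by linarith
  ring_nf
  rw [h1', h2']
  ring

lemma norm_sq_postVel_sub_postVel_right (v w₁ w₂ : Plane) (θ : ℝ) :
    ‖postVel v w₁ θ - postVel v w₂ θ‖ ^ 2 = (1 - Real.cos θ) / 2 * ‖w₁ - w₂‖ ^ 2 := by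
  rw [norm_sq_plane, norm_sq_plane]
  unfold postVel
  simp
  have h1' : Real.sin θ ^ 2 = 1 - Real.cos θ ^ 2 := by
    have h1 := Real.sin_sq_add_cos_sq θ
    linarith
  ring_nf
  rw [h1']
  ring

/-! ### The uniform distribution on a circle -/

lemma measurable_circle_param (r : ℝ) :
    Measurable fun α : ℝ => (!₂[r * Real.cos α, r * Real.sin α] : Plane) := by
  have : (fun α : ℝ => (!₂[r * Real.cos α, r * Real.sin α] : Plane)) = fun α => rot α !₂[r, 0] := by
    funext α
    apply plane_ext <;> simp <;> ring
  rw [this]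
  exact (continuous_rot_uncurry.comp (by fun_prop : Continuous fun α : ℝ =>
    (α, (!₂[r, 0] : Plane)))).measurable

lemma lintegral_uniformCircle (r : ℝ) {g : Plane → ℝ≥0∞} (hg : Measurable g) :
    ∫⁻ w, g w ∂(uniformCircle r) = ENNReal.ofReal (1 / (2 * Real.pi)) *
      ∫⁻ a in Ioc (-Real.pi) Real.pi, g !₂[r * Real.cos a, r * Real.sin a] := by
  unfold uniformCircle
  rw [lintegral_smul_measure, lintegral_map hg (measurable_circle_param r), smul_eq_mul]

lemma integral_uniformCircle (r : ℝ) {g : Plane → ℝ} (hg : Continuous g) :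
    ∫ w, g w ∂(uniformCircle r) = (1 / (2 * Real.pi)) *
      ∫ a in (-Real.pi)..Real.pi, g !₂[r * Real.cos a, r * Real.sin a] := by
  unfold uniformCircle
  rw [integral_smul_measure, integral_map (measurable_circle_param r).aemeasurable
    hg.aestronglyMeasurable, ENNReal.toReal_ofReal (by positivity), smul_eq_mul,
    intervalIntegral.integral_of_le (by linarith [Real.pi_pos])]

instance (r : ℝ) : IsProbabilityMeasure (uniformCircle r) := by
  constructor
  have := lintegral_uniformCircle r (g := fun _ => 1) measurable_const
  simp only [lintegral_const, one_mul, Measure.restrict_apply_univ, Real.volume_Ioc] at this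
  rw [this, ← ENNReal.ofReal_mul (by positivity)]
  rw [show 1 / (2 * Real.pi) * (Real.pi - -Real.pi) = 1 by field_simp; ring]
  simp

/-- Properties of almost all points of the circle can be checked on the parametrization. -/
lemma ae_uniformCircle (r : ℝ) {p : Plane → Prop} (hp : MeasurableSet {x | p x})
    (h : ∀ᵐ a ∂(volume.restrict (Ioc (-Real.pi) Real.pi)),
      p !₂[r * Real.cos a, r * Real.sin a]) : ∀ᵐ w ∂(uniformCircle r), p w := by
  unfold uniformCircle
  exact Measure.ae_smul_measure ((ae_map_iff (measurable_circle_param r).aemeasurable hp).2 h) _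

lemma norm_circle_param {r : ℝ} (hr : 0 ≤ r) (a : ℝ) :
    ‖(!₂[r * Real.cos a, r * Real.sin a] : Plane)‖ = r := by
  rw [← sq_eq_sq₀ (norm_nonneg _) hr, norm_sq_plane]
  simp
  linear_combination r ^ 2 * Real.sin_sq_add_cos_sq a

lemma ae_norm_uniformCircle {r : ℝ} (hr : 0 ≤ r) : ∀ᵐ w ∂(uniformCircle r), ‖w‖ = r :=
  ae_uniformCircle r (measurableSet_eq_fun measurable_norm measurable_const)
    (Eventually.of_forall (norm_circle_param hr))

/-- Rotational symmetry of a measure on the plane. -/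
def RotInvariant (μ : Measure Plane) : Prop := ∀ η, μ.map (rot η) = μ

lemma rot_circle_param (r η a : ℝ) :
    rot η !₂[r * Real.cos a, r * Real.sin a] = !₂[r * Real.cos (a + η), r * Real.sin (a + η)] := by
  apply plane_ext <;> simp [Real.cos_add, Real.sin_add] <;> ring

lemma rotInvariant_of_integral {μ : Measure Plane} [IsFiniteMeasure μ]
    (h : ∀ η (φ : BoundedContinuousFunction Plane ℝ), ∫ v, φ (rot η v) ∂μ = ∫ v, φ v ∂μ) :
    RotInvariant μ := by
  intro η
  have : IsFiniteMeasure (μ.map (rot η)) := Measure.isFiniteMeasure_map _ _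
  refine ext_of_forall_integral_eq_of_IsFiniteMeasure fun φ => ?_
  rw [integral_map (measurable_rot η).aemeasurable φ.continuous.aestronglyMeasurable, h]

lemma rotInvariant_uniformCircle (r : ℝ) : RotInvariant (uniformCircle r) := by
  refine rotInvariant_of_integral fun η φ => ?_
  rw [integral_uniformCircle r (g := fun v => φ (rot η v))
    (φ.continuous.comp (continuous_rot η)),
    integral_uniformCircle r φ.continuous]
  congr 1
  simp only [rot_circle_param]
  set F : ℝ → ℝ := fun a => φ !₂[r * Real.cos a, r * Real.sin a]
  have hF : Function.Periodic F (2 * Real.pi) := fun a => by simp [F]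
  have h1 := hF.intervalIntegral_add_eq (-Real.pi + η) (-Real.pi)
  change ∫ a in (-Real.pi)..Real.pi, F (a + η) = ∫ a in (-Real.pi)..Real.pi, F a
  rw [intervalIntegral.integral_comp_add_right]
  convert h1 using 2 <;> ring

lemma RotInvariant.lintegral_comp {μ : Measure Plane} (h : RotInvariant μ) (η : ℝ)
    {g : Plane → ℝ≥0∞} (hg : Measurable g) : ∫⁻ w, g (rot η w) ∂μ = ∫⁻ w, g w ∂μ := by
  conv_rhs => rw [← h η]
  rw [lintegral_map hg (measurable_rot η)]

lemma RotInvariant.integral_comp {μ : Measure Plane} (h : RotInvariant μ) (η : ℝ)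
    (g : Plane → ℝ) : ∫ w, g (rot η w) ∂μ = ∫ w, g w ∂μ := by
  conv_rhs => rw [← h η]
  exact ((rotEquiv η).measurableEmbedding.integral_map g).symm

/-! ### Riesz potentials of the uniform distribution on a circle -/

lemma integrable_and_integral_le {α : Type*} [MeasurableSpace α] {μ : Measure α} {f : α → ℝ}
    (hm : AEStronglyMeasurable f μ) (h0 : ∀ x, 0 ≤ f x) {C : ℝ} (hC : 0 ≤ C)
    (h : ∫⁻ x, ENNReal.ofReal (f x) ∂μ ≤ ENNReal.ofReal C) :
    Integrable f μ ∧ ∫ x, f x ∂μ ≤ C := by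
  have hi : Integrable f μ := by
    refine ⟨hm, ?_⟩
    rw [hasFiniteIntegral_iff_ofReal (Eventually.of_forall h0)]
    exact h.trans_lt ENNReal.ofReal_lt_top
  refine ⟨hi, ?_⟩
  rw [← ENNReal.ofReal_le_ofReal_iff hC,
    ofReal_integral_eq_lintegral_ofReal hi (Eventually.of_forall h0)]
  exact h

lemma norm_axis_sub_circle_ge {r ρ a : ℝ} (hr : 0 ≤ r) (hρ : 0 ≤ ρ) (ha : |a| ≤ Real.pi) :
    r * (|a| / Real.pi) ≤ ‖(!₂[ρ, 0] : Plane) - !₂[r * Real.cos a, r * Real.sin a]‖ := by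
  have hπ := Real.pi_pos
  rw [← sq_le_sq₀ (by positivity) (norm_nonneg _), norm_sq_plane]
  simp only [PiLp.sub_apply, Matrix.cons_val_zero, Matrix.cons_val_one, zero_sub, neg_sq, mul_pow]
  have h1 := Real.sin_sq_add_cos_sq a
  rcases le_total |a| (Real.pi / 2) with h | h
  · have h2 := Real.mul_abs_le_abs_sin h
    have h3 : (|a| / Real.pi) ^ 2 ≤ Real.sin a ^ 2 := by
      rw [← sq_abs (Real.sin a)]
      gcongr
      calc |a| / Real.pi ≤ 2 / Real.pi * |a| := by
            rw [div_mul_eq_mul_div]; gcongr; linarith [abs_nonneg a]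
        _ ≤ _ := h2
    nlinarith [sq_nonneg (ρ - r * Real.cos a), sq_nonneg r,
      mul_le_mul_of_nonneg_left h3 (sq_nonneg r)]
  · have hc : Real.cos a ≤ 0 := by
      rw [← Real.cos_abs]
      exact Real.cos_nonpos_of_pi_div_two_le_of_le h (by linarith)
    have h3 : (|a| / Real.pi) ^ 2 ≤ 1 := by
      apply pow_le_one₀ (by positivity)
      rw [div_le_one hπ]; exact ha
    have h4 := mul_le_mul_of_nonneg_left h3 (sq_nonneg r)
    have h5 : r * Real.cos a ≤ 0 := mul_nonpos_of_nonneg_of_nonpos hr hc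
    nlinarith [mul_nonneg hρ (neg_nonneg.2 h5), sq_nonneg ρ]

lemma lintegral_Ioc_abs (G : ℝ → ℝ≥0∞) (c : ℝ) (hc : 0 ≤ c) :
    ∫⁻ a in Ioc (-c) c, G |a| = 2 * ∫⁻ a in Ioc 0 c, G a := by
  rw [← Ioc_union_Ioc_eq_Ioc (neg_nonpos.2 hc) hc,
    lintegral_union measurableSet_Ioc (by
      rw [Set.disjoint_left]; rintro x ⟨_, h⟩ ⟨h', _⟩; linarith)]
  have h1 : ∫⁻ a in Ioc 0 c, G |a| = ∫⁻ a in Ioc 0 c, G a :=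
    setLIntegral_congr_fun measurableSet_Ioc fun a ha => by rw [abs_of_pos ha.1]
  have h2 : ∫⁻ a in Ioc (-c) 0, G |a| = ∫⁻ a in Ioc 0 c, G a := by
    have := (Measure.measurePreserving_neg (volume : Measure ℝ)).setLIntegral_comp_preimage_emb
      (MeasurableEquiv.neg ℝ).measurableEmbedding (fun a => G |a|) (Ico 0 c)
    simp only [abs_neg] at this
    rw [← h1, ← setLIntegral_congr (Ico_ae_eq_Ioc (a := (0 : ℝ)) (b := c)), ← this]
    congr 2
    ext x; simp
  rw [h1, h2, two_mul]

/-- Integrals of functions of `|v - v_*|` against the uniform distribution on the circle are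
controlled by one-dimensional integrals: after a rotation bringing `v` to the first axis, the
distance from `v` to the point of angle `a` is at least `r |a| / π`. -/
lemma lintegral_norm_sub_le {r : ℝ} (hr : 0 ≤ r) (v : Plane) {F G : ℝ → ℝ≥0∞}
    (hF : Measurable F)
    (h : ∀ a > 0, ∀ x, r * (a / Real.pi) ≤ x → |‖v‖ - r| ≤ x → F x ≤ G a) :
    ∫⁻ w, F ‖v - w‖ ∂(uniformCircle r) ≤
      ENNReal.ofReal (1 / Real.pi) * ∫⁻ a in Ioc 0 Real.pi, G a := by
  have hπ := Real.pi_pos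
  obtain ⟨η, hη⟩ := exists_eq_rot v
  have h1 : ∫⁻ w, F ‖v - w‖ ∂(uniformCircle r)
      = ∫⁻ w, F ‖!₂[‖v‖, 0] - w‖ ∂(uniformCircle r) := by
    rw [← (rotInvariant_uniformCircle r).lintegral_comp η (g := fun w => F ‖v - w‖)
      (hF.comp (measurable_const.sub measurable_id).norm)]
    refine lintegral_congr fun w => ?_
    conv_lhs => rw [hη]
    rw [← rot_sub, norm_rot]
  rw [h1, lintegral_uniformCircle r (g := fun w => F ‖!₂[‖v‖, 0] - w‖) (hF.comp (measurable_const.sub measurable_id).norm)]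
  have h2 : ENNReal.ofReal (1 / Real.pi) = ENNReal.ofReal (1 / (2 * Real.pi)) * 2 := by
    rw [← ENNReal.ofReal_ofNat, ← ENNReal.ofReal_mul (by positivity)]
    congr 1; field_simp
  rw [h2, mul_assoc, ← lintegral_Ioc_abs G Real.pi hπ.le]
  refine mul_le_mul' le_rfl (lintegral_mono_ae ?_)
  have h0 : ∀ᵐ a ∂(volume.restrict (Ioc (-Real.pi) Real.pi)), a ≠ 0 :=
    ae_restrict_of_ae (Measure.ae_ne volume 0)
  filter_upwards [h0, ae_restrict_mem measurableSet_Ioc] with a ha0 ha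
  refine h |a| (abs_pos.2 ha0) _ ?_ ?_
  · exact norm_axis_sub_circle_ge hr (norm_nonneg _) (abs_le.2 ⟨ha.1.le, ha.2⟩)
  · have := abs_norm_sub_norm_le (!₂[‖v‖, 0] : Plane) !₂[r * Real.cos a, r * Real.sin a]
    rw [norm_circle_param hr] at this
    have h3 : ‖(!₂[‖v‖, 0] : Plane)‖ = ‖v‖ := by
      conv_rhs => rw [hη]
      rw [norm_rot]
    rwa [h3] at this

lemma uniformCircle_singleton {r : ℝ} (hr : 0 < r) (v : Plane) : uniformCircle r {v} = 0 := by
  have h := lintegral_norm_sub_le hr.le v (F := indicator {0} 1) (G := 0)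
    (measurable_one.indicator (measurableSet_singleton 0)) (fun a ha x hx _ => by
      have : 0 < r * (a / Real.pi) := by positivity [Real.pi_pos]
      rw [indicator_of_notMem]; · simp
      simp; linarith)
  simp only [Pi.zero_apply, lintegral_zero, mul_zero, nonpos_iff_eq_zero] at h
  rw [← h, ← lintegral_indicator_one (measurableSet_singleton v)]
  refine lintegral_congr fun w => ?_
  by_cases hw : w = v
  · subst hw; simp
  · rw [indicator_of_notMem, indicator_of_notMem]
    · simp [sub_eq_zero]; exact fun h => hw h.symm
    · simpa using hw

lemma ae_ne_uniformCircle {r : ℝ} (hr : 0 < r) (v : Plane) : ∀ᵐ w ∂(uniformCircle r), w ≠ v := by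
  rw [ae_iff]
  simpa using uniformCircle_singleton hr v

/-- Riesz potentials of order greater than `-1` of the circle are bounded on the plane. -/
lemma exists_potential_bound {r : ℝ} (hr : 0 < r) {p : ℝ} (hp : -1 < p) (hp0 : p < 0) :
    ∃ C, 0 ≤ C ∧ ∀ v : Plane, Integrable (fun w => ‖v - w‖ ^ p) (uniformCircle r) ∧
      ∫ w, ‖v - w‖ ^ p ∂(uniformCircle r) ≤ C := by
  have hπ := Real.pi_pos
  have hI : IntegrableOn (fun a : ℝ => (r * (a / Real.pi)) ^ p) (Ioc 0 Real.pi) := by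
    have h1 : IntegrableOn (fun a : ℝ => (r / Real.pi) ^ p * a ^ p) (Ioc 0 Real.pi) := by
      rw [← intervalIntegrable_iff_integrableOn_Ioc_of_le hπ.le]
      exact (intervalIntegral.intervalIntegrable_rpow' hp).const_mul _
    refine h1.congr_fun (fun a ha => ?_) measurableSet_Ioc
    simp only
    rw [← Real.mul_rpow (by positivity) ha.1.le]
    congr 1; ring
  have hI0 : 0 ≤ᵐ[volume.restrict (Ioc 0 Real.pi)] fun a : ℝ => (r * (a / Real.pi)) ^ p := by
    filter_upwards [ae_restrict_mem measurableSet_Ioc] with a ha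
    have := ha.1
    simp only [Pi.zero_apply]; positivity
  have hC : 0 ≤ (1 / Real.pi) * ∫ a in Ioc 0 Real.pi, (r * (a / Real.pi)) ^ p :=
    mul_nonneg (by positivity) (integral_nonneg_of_ae hI0)
  refine ⟨_, hC, fun v => ?_⟩
  refine integrable_and_integral_le ?_ (fun w => by positivity) hC ?_
  · exact ((measurable_const.sub measurable_id).norm.pow_const p).aestronglyMeasurable
  rw [ENNReal.ofReal_mul (by positivity), ofReal_integral_eq_lintegral_ofReal hI hI0]
  refine lintegral_norm_sub_le hr.le v (F := fun x => ENNReal.ofReal (x ^ p))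
    (G := fun a => ENNReal.ofReal ((r * (a / Real.pi)) ^ p))
    (measurable_id.pow_const p).ennreal_ofReal ?_
  intro a ha x hx _
  exact ENNReal.ofReal_le_ofReal (Real.rpow_le_rpow_of_nonpos (by positivity) hx hp0.le)

/-- Riesz potentials of order less than `-1` of the circle blow up at most like the distance to
the circle to the power `order + 1`. -/
lemma exists_potential_bound_off_circle {r : ℝ} (hr : 0 < r) {γ : ℝ} (hγ : γ < -1) :
    ∃ C, 0 ≤ C ∧ ∀ v : Plane, ‖v‖ ≠ r → Integrable (fun w => ‖v - w‖ ^ γ) (uniformCircle r) ∧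
      ∫ w, ‖v - w‖ ^ γ ∂(uniformCircle r) ≤ C * |‖v‖ - r| ^ (γ + 1) := by
  have hπ := Real.pi_pos
  set c : ℝ := r / (2 * Real.pi) with hc
  have hc0 : 0 < c := by positivity
  refine ⟨(1 / Real.pi) * (c⁻¹ * ((2⁻¹ : ℝ) ^ (γ + 1) / (-(γ + 1)))), ?_, fun v hv => ?_⟩
  · have : 0 < -(γ + 1) := by linarith
    positivity
  set D := |‖v‖ - r| with hD
  have hD0 : 0 < D := abs_pos.2 (sub_ne_zero.2 hv)
  have hγ1 : 0 < -(γ + 1) := by linarith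
  have hpos : ∀ a ∈ Icc 0 Real.pi, 0 < c * a + D / 2 := fun a ha => by
    have := mul_nonneg hc0.le ha.1
    linarith
  have hcont : ContinuousOn (fun a : ℝ => (c * a + D / 2) ^ γ) (Icc 0 Real.pi) :=
    ContinuousOn.rpow_const (by fun_prop) fun a ha => Or.inl (hpos a ha).ne'
  have hI : IntegrableOn (fun a : ℝ => (c * a + D / 2) ^ γ) (Ioc 0 Real.pi) :=
    (hcont.integrableOn_compact isCompact_Icc).mono_set Ioc_subset_Icc_self
  have hI0 : 0 ≤ᵐ[volume.restrict (Ioc 0 Real.pi)] fun a : ℝ => (c * a + D / 2) ^ γ := by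
    filter_upwards [ae_restrict_mem measurableSet_Ioc] with a ha
    exact (Real.rpow_pos_of_pos (hpos a (Ioc_subset_Icc_self ha)) γ).le
  have hval : ∫ a in Ioc 0 Real.pi, (c * a + D / 2) ^ γ ≤
      c⁻¹ * ((2⁻¹ : ℝ) ^ (γ + 1) / (-(γ + 1))) * D ^ (γ + 1) := by
    rw [← intervalIntegral.integral_of_le hπ.le,
      intervalIntegral.integral_comp_mul_add (fun x => x ^ γ) hc0.ne', smul_eq_mul, mul_assoc]
    refine mul_le_mul_of_nonneg_left ?_ (by positivity)
    rw [integral_rpow]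
    · have h1 : (D / 2) ^ (γ + 1) = D ^ (γ + 1) * (2⁻¹ : ℝ) ^ (γ + 1) := by
        rw [← Real.mul_rpow hD0.le (by norm_num)]; rfl
      have h2 : 0 ≤ (c * Real.pi + D / 2) ^ (γ + 1) := by positivity
      rw [mul_zero, zero_add, h1, ← neg_div_neg_eq, div_mul_eq_mul_div ((2⁻¹ : ℝ) ^ (γ + 1))]
      refine div_le_div_of_nonneg_right ?_ hγ1.le
      linarith
    · right
      refine ⟨by linarith, ?_⟩
      rw [mul_zero, zero_add, uIcc_of_le (by nlinarith)]
      intro h0; linarith [h0.1]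
  refine integrable_and_integral_le ?_ (fun w => by positivity) (by positivity) ?_
  · exact ((measurable_const.sub measurable_id).norm.pow_const γ).aestronglyMeasurable
  rw [mul_assoc, ENNReal.ofReal_mul (by positivity)]
  refine (lintegral_norm_sub_le hr.le v (F := fun x => ENNReal.ofReal (x ^ γ))
    (G := fun a => ENNReal.ofReal ((c * a + D / 2) ^ γ))
    (measurable_id.pow_const γ).ennreal_ofReal ?_).trans ?_
  · intro a ha x hx hx'
    refine ENNReal.ofReal_le_ofReal (Real.rpow_le_rpow_of_nonpos (by positivity) ?_ (by linarith))
    have : c * a = r * (a / Real.pi) / 2 := by rw [hc]; field_simp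
    rw [this]; linarith
  · rw [← ofReal_integral_eq_lintegral_ofReal hI hI0]
    gcongr

/-! ### The jump generator and its truncations -/

/-- The generator of the jump process: a particle of velocity `v` collides with a partner `v_*`,
uniform on the circle of radius `r`, with the angle `θ` at rate `ρ(|v - v_*|) f₀(dv_*) β(dθ)`. -/
noncomputable def jumpGen (r : ℝ) (β : Measure ℝ) (ρ : ℝ → ℝ) (φ : Plane → ℝ) (v : Plane) : ℝ :=
  ∫ p : Plane × ℝ, ρ ‖v - p.1‖ * (φ (postVel v p.1 p.2) - φ v) ∂((uniformCircle r).prod β)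

/-- The rate `x ^ γ`, frozen below the distance `δ`. -/
noncomputable def truncRate (γ δ x : ℝ) : ℝ := max x δ ^ γ

lemma lipschitzWith_max_rpow {p δ : ℝ} (hp : p ≤ 1) (hδ : 0 < δ) :
    LipschitzWith (Real.toNNReal (|p| * δ ^ (p - 1))) fun x : ℝ => max x δ ^ p := by
  have h1 : LipschitzOnWith (Real.toNNReal (|p| * δ ^ (p - 1))) (fun x : ℝ => x ^ p) (Ici δ) := by
    refine (convex_Ici δ).lipschitzOnWith_of_nnnorm_deriv_le (fun x hx => ?_) fun x hx => ?_
    · exact (Real.hasDerivAt_rpow_const (Or.inl (hδ.trans_le hx).ne')).differentiableAt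
    · have hx0 : 0 < x := hδ.trans_le hx
      rw [Real.deriv_rpow_const, ← NNReal.coe_le_coe, coe_nnnorm, Real.coe_toNNReal _ (by positivity),
        Real.norm_eq_abs, abs_mul, abs_of_pos (Real.rpow_pos_of_pos hx0 _)]
      gcongr ?_ * ?_
      exact Real.rpow_le_rpow_of_nonpos hδ hx (by linarith)
  have h2 : LipschitzWith 1 fun x : ℝ => max x δ := LipschitzWith.id.max_const δ
  have h3 := h1.comp (h2.lipschitzOnWith (s := univ)) (fun x _ => le_max_right x δ)
  rw [mul_one] at h3
  exact lipschitzOnWith_univ.1 h3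

lemma truncRate_nonneg {γ δ : ℝ} (hδ : 0 < δ) (x : ℝ) : 0 ≤ truncRate γ δ x :=
  Real.rpow_nonneg (hδ.le.trans (le_max_right _ _)) _

lemma truncRate_le {γ δ : ℝ} (hγ : γ ≤ 0) (hδ : 0 < δ) (x : ℝ) : truncRate γ δ x ≤ δ ^ γ :=
  Real.rpow_le_rpow_of_nonpos hδ (le_max_right _ _) hγ

lemma measurable_truncRate (γ δ : ℝ) : Measurable (truncRate γ δ) :=
  (measurable_id.max measurable_const).pow_const γ

lemma rpow_mul_self_le {γ x : ℝ} (hx : 0 ≤ x) : x ^ γ * x ≤ x ^ (γ + 1) := by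
  rcases hx.eq_or_lt with rfl | hx
  · rw [mul_zero]; positivity
  · rw [Real.rpow_add_one hx.ne']

lemma truncRate_mul_self_le {γ δ x : ℝ} (hγ : γ ≤ 0) (hx : 0 ≤ x) :
    truncRate γ δ x * x ≤ x ^ (γ + 1) := by
  rcases hx.eq_or_lt with rfl | hx
  · rw [mul_zero]; positivity
  · rw [Real.rpow_add_one hx.ne']
    gcongr
    exact Real.rpow_le_rpow_of_nonpos hx (le_max_left _ _) hγ

lemma abs_truncRate_sub_mul_self_le {γ δ x : ℝ} (hγ : γ ≤ 0) (hγ2 : -2 ≤ γ) (hδ : 0 < δ)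
    (hx : 0 ≤ x) : |truncRate γ δ x - x ^ γ| * x ≤ δ ^ (γ / 2 + 1) * x ^ (γ / 2) := by
  rcases le_total δ x with h | h
  · rw [truncRate, max_eq_left h, sub_self, abs_zero, zero_mul]
    positivity
  rcases hx.eq_or_lt with rfl | hx
  · rw [mul_zero]; positivity
  have h1 : δ ^ γ ≤ x ^ γ := Real.rpow_le_rpow_of_nonpos hx h hγ
  have h2 : x ^ (γ / 2 + 1) ≤ δ ^ (γ / 2 + 1) := Real.rpow_le_rpow hx.le h (by linarith)
  have h3 : x ^ γ * x = x ^ (γ / 2 + 1) * x ^ (γ / 2) := by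
    rw [← Real.rpow_add hx, ← Real.rpow_add_one hx.ne']; congr 1; ring
  rw [truncRate, max_eq_right h, abs_sub_comm, abs_of_nonneg (by linarith)]
  calc (x ^ γ - δ ^ γ) * x ≤ x ^ γ * x := by
        gcongr; linarith [Real.rpow_pos_of_pos hδ γ]
    _ ≤ _ := by rw [h3]; gcongr

lemma continuous_postVel_right (v : Plane) : Continuous fun p : Plane × ℝ => postVel v p.1 p.2 :=
  (continuous_postVel.comp (Continuous.prodMk_right v)).congr fun _ => rfl

lemma measurable_jump_integrand {ρ : ℝ → ℝ} (hρ : Measurable ρ) {φ : Plane → ℝ}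
    (hφ : Continuous φ) (v : Plane) :
    Measurable fun p : Plane × ℝ => ρ ‖v - p.1‖ * (φ (postVel v p.1 p.2) - φ v) := by
  have h : Measurable fun p : Plane × ℝ => ‖v - p.1‖ := by
    have : Continuous fun p : Plane × ℝ => v - p.1 := continuous_const.sub continuous_fst
    exact this.norm.measurable
  exact (hρ.comp h).mul
    ((hφ.comp (continuous_postVel_right v)).measurable.sub measurable_const)

lemma abs_jump_integrand_le {ρ : ℝ → ℝ} {M p : ℝ} (hρ : ∀ x, 0 ≤ x → |ρ x| * x ≤ M * x ^ p)
    {φ : Plane → ℝ} {K : ℝ≥0} (hφ : LipschitzWith K φ) (v w : Plane) (θ : ℝ) :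
    |ρ ‖v - w‖ * (φ (postVel v w θ) - φ v)| ≤ K * M * ‖v - w‖ ^ p := by
  rw [abs_mul]
  have h1 : |φ (postVel v w θ) - φ v| ≤ K * ‖v - w‖ := by
    have := hφ.dist_le_mul (postVel v w θ) v
    rw [Real.dist_eq, dist_eq_norm] at this
    exact this.trans (mul_le_mul_of_nonneg_left (norm_postVel_sub_le v w θ) K.2)
  calc |ρ ‖v - w‖| * |φ (postVel v w θ) - φ v| ≤ |ρ ‖v - w‖| * (K * ‖v - w‖) := by gcongr
    _ = K * (|ρ ‖v - w‖| * ‖v - w‖) := by ring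
    _ ≤ K * (M * ‖v - w‖ ^ p) := mul_le_mul_of_nonneg_left (hρ _ (norm_nonneg _)) K.2
    _ = _ := by ring

/-- On Lipschitz functions, the generator only sees the rate multiplied by the distance. -/
lemma integrable_jump_of_lipschitz {r : ℝ} {β : Measure ℝ} [IsFiniteMeasure β] {ρ : ℝ → ℝ}
    (hρm : Measurable ρ) {M p C : ℝ} (hρ : ∀ x, 0 ≤ x → |ρ x| * x ≤ M * x ^ p) (hM : 0 ≤ M)
    (hC : ∀ v : Plane, Integrable (fun w => ‖v - w‖ ^ p) (uniformCircle r) ∧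
      ∫ w, ‖v - w‖ ^ p ∂(uniformCircle r) ≤ C)
    {φ : Plane → ℝ} {K : ℝ≥0} (hφ : LipschitzWith K φ) (v : Plane) :
    Integrable (fun q : Plane × ℝ => ρ ‖v - q.1‖ * (φ (postVel v q.1 q.2) - φ v))
      ((uniformCircle r).prod β) ∧ |jumpGen r β ρ φ v| ≤ K * (M * (β.real univ * C)) := by
  have hd : Integrable (fun q : Plane × ℝ => K * M * ‖v - q.1‖ ^ p)
      ((uniformCircle r).prod β) := ((hC v).1.const_mul (K * M)).comp_fst β
  refine ⟨hd.mono' (measurable_jump_integrand hρm hφ.continuous v).aestronglyMeasurable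
    (Eventually.of_forall fun q => abs_jump_integrand_le hρ hφ v q.1 q.2), ?_⟩
  refine (norm_integral_le_of_norm_le
    (f := fun q : Plane × ℝ => ρ ‖v - q.1‖ * (φ (postVel v q.1 q.2) - φ v)) hd
    (Eventually.of_forall fun q => abs_jump_integrand_le hρ hφ v q.1 q.2)).trans ?_
  rw [integral_fun_fst (fun w => K * M * ‖v - w‖ ^ p), integral_const_mul, smul_eq_mul]
  calc β.real univ * (K * M * ∫ w, ‖v - w‖ ^ p ∂(uniformCircle r))
      ≤ β.real univ * (K * M * C) := by gcongr; exact (hC v).2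
    _ = _ := by ring

lemma integrable_jump_of_bounded {r : ℝ} {β : Measure ℝ} [IsFiniteMeasure β] {ρ : ℝ → ℝ}
    (hρm : Measurable ρ) {B M : ℝ} (hρ : ∀ x, |ρ x| ≤ B)
    {φ : Plane → ℝ} (hφ : Continuous φ) (hM : ∀ v, |φ v| ≤ M) (v : Plane) :
    Integrable (fun q : Plane × ℝ => ρ ‖v - q.1‖ * (φ (postVel v q.1 q.2) - φ v))
      ((uniformCircle r).prod β) := by
  refine Integrable.of_bound (measurable_jump_integrand hρm hφ v).aestronglyMeasurable
    (B * (M + M)) (Eventually.of_forall fun q => ?_)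
  rw [Real.norm_eq_abs, abs_mul]
  have hB : 0 ≤ B := (abs_nonneg _).trans (hρ 0)
  gcongr
  · exact hρ _
  · exact (abs_sub _ _).trans (add_le_add (hM _) (hM _))

lemma lipschitzWith_jumpGen {r : ℝ} {β : Measure ℝ} [IsFiniteMeasure β] {ρ : ℝ → ℝ} {A : ℝ≥0}
    (hρA : LipschitzWith A ρ) {B M : ℝ} (hρ : ∀ x, |ρ x| ≤ B)
    {φ : Plane → ℝ} {K : ℝ≥0} (hφ : LipschitzWith K φ) (hM : ∀ v, |φ v| ≤ M) :
    ∃ K', LipschitzWith K' (jumpGen r β ρ φ) := by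
  have hB : 0 ≤ B := (abs_nonneg _).trans (hρ 0)
  have hM0 : 0 ≤ M := (abs_nonneg _).trans (hM 0)
  refine ⟨Real.toNNReal ((A * (M + M) + B * (K + K)) * β.real univ),
    LipschitzWith.of_dist_le_mul fun v₁ v₂ => ?_⟩
  rw [Real.coe_toNNReal _ (by positivity), Real.dist_eq, dist_eq_norm]
  unfold jumpGen
  rw [← integral_sub
    (integrable_jump_of_bounded hρA.continuous.measurable hρ hφ.continuous hM v₁)
    (integrable_jump_of_bounded hρA.continuous.measurable hρ hφ.continuous hM v₂)]
  have hu : ((uniformCircle r).prod β).real univ = β.real univ := by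
    rw [← univ_prod_univ, measureReal_prod_prod]; simp
  have hφ' : ∀ x y, |φ x - φ y| ≤ K * ‖x - y‖ := fun x y => by
    simpa [Real.dist_eq, dist_eq_norm] using hφ.dist_le_mul x y
  have key := norm_integral_le_of_norm_le_const (μ := (uniformCircle r).prod β)
    (f := fun q : Plane × ℝ => ρ ‖v₁ - q.1‖ * (φ (postVel v₁ q.1 q.2) - φ v₁) -
      ρ ‖v₂ - q.1‖ * (φ (postVel v₂ q.1 q.2) - φ v₂))
    (C := (A * (M + M) + B * (K + K)) * ‖v₁ - v₂‖) (Eventually.of_forall fun q => ?_)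
  · rw [hu, Real.norm_eq_abs] at key
    refine key.trans (le_of_eq ?_)
    ring
  · rw [Real.norm_eq_abs]
    have e : ρ ‖v₁ - q.1‖ * (φ (postVel v₁ q.1 q.2) - φ v₁) -
        ρ ‖v₂ - q.1‖ * (φ (postVel v₂ q.1 q.2) - φ v₂) =
        (ρ ‖v₁ - q.1‖ - ρ ‖v₂ - q.1‖) * (φ (postVel v₁ q.1 q.2) - φ v₁) +
        ρ ‖v₂ - q.1‖ * ((φ (postVel v₁ q.1 q.2) - φ (postVel v₂ q.1 q.2)) - (φ v₁ - φ v₂)) := by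
      ring
    rw [e]
    refine (abs_add_le _ _).trans ?_
    rw [abs_mul, abs_mul]
    have h1 : |ρ ‖v₁ - q.1‖ - ρ ‖v₂ - q.1‖| ≤ A * ‖v₁ - v₂‖ := by
      have := hρA.dist_le_mul ‖v₁ - q.1‖ ‖v₂ - q.1‖
      rw [Real.dist_eq, Real.dist_eq] at this
      refine this.trans ?_
      gcongr
      simpa using abs_norm_sub_norm_le (v₁ - q.1) (v₂ - q.1)
    have h2 : |φ (postVel v₁ q.1 q.2) - φ v₁| ≤ M + M :=
      (abs_sub _ _).trans (add_le_add (hM _) (hM _))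
    have h3 : |(φ (postVel v₁ q.1 q.2) - φ (postVel v₂ q.1 q.2)) - (φ v₁ - φ v₂)|
        ≤ (K + K) * ‖v₁ - v₂‖ := by
      refine (abs_sub _ _).trans ?_
      have := (hφ' (postVel v₁ q.1 q.2) (postVel v₂ q.1 q.2)).trans
        (mul_le_mul_of_nonneg_left (postVel_sub_postVel_left v₁ v₂ q.1 q.2) K.2)
      have h4 := hφ' v₁ v₂
      rw [add_mul]
      exact add_le_add this h4
    calc _ ≤ (A * ‖v₁ - v₂‖) * (M + M) + B * ((K + K) * ‖v₁ - v₂‖) := by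
          gcongr
          exact hρ _
      _ = _ := by ring

lemma jumpGen_rot (r : ℝ) (β : Measure ℝ) [IsFiniteMeasure β] (ρ : ℝ → ℝ) (φ : Plane → ℝ)
    (η : ℝ) (v : Plane) :
    jumpGen r β ρ φ (rot η v) = jumpGen r β ρ (fun x => φ (rot η x)) v := by
  unfold jumpGen
  have hp : MeasurePreserving (rotEquiv η) (uniformCircle r) (uniformCircle r) :=
    ⟨measurable_rot η, rotInvariant_uniformCircle r η⟩
  have hp2 : MeasurePreserving (MeasurableEquiv.prodCongr (rotEquiv η) (MeasurableEquiv.refl ℝ))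
      ((uniformCircle r).prod β) ((uniformCircle r).prod β) := hp.prod (MeasurePreserving.id β)
  rw [← hp2.integral_comp']
  refine integral_congr_ae (Eventually.of_forall fun q => ?_)
  change ρ ‖rot η v - rot η q.1‖ * (φ (postVel (rot η v) (rot η q.1) q.2) - φ (rot η v)) = _
  rw [postVel_rot, ← rot_sub, norm_rot]

lemma collision_eq {γ : ℝ} {β : Measure ℝ} (hβ : IsCrossSection β) (φ : Plane → ℝ)
    (v w : Plane) :
    collision γ β φ v w = ‖v - w‖ ^ γ * ∫ θ, (φ (postVel v w θ) - φ v) ∂β := by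
  have h : β.restrict (Icc (-(Real.pi / 2)) (Real.pi / 2)) = β := by
    refine Measure.restrict_eq_self_of_ae_mem ?_
    have h1 : ∀ᵐ θ ∂β, θ ∈ Icc (-(Real.pi / 2)) (Real.pi / 2) \ {0} := hβ.carrier
    exact h1.mono fun θ hθ => hθ.1
  unfold collision
  rw [h]
  split_ifs with hvw
  · subst hvw
    simp [postVel_self]
  · rfl

/-- The generator with rate `|v - v_*| ^ γ` is the `f₀`-average of the collision operator. -/
lemma integral_collision_eq_jumpGen {r γ : ℝ} {β : Measure ℝ} [IsFiniteMeasure β]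
    (hβ : IsCrossSection β) {φ : Plane → ℝ} {v : Plane}
    (hi : Integrable (fun q : Plane × ℝ => ‖v - q.1‖ ^ γ * (φ (postVel v q.1 q.2) - φ v))
      ((uniformCircle r).prod β)) :
    ∫ w, collision γ β φ v w ∂(uniformCircle r) = jumpGen r β (fun x => x ^ γ) φ v := by
  unfold jumpGen
  rw [integral_prod _ hi]
  refine integral_congr_ae (Eventually.of_forall fun w => ?_)
  simp only
  rw [collision_eq hβ, integral_const_mul]

/-- For a Lipschitz function, the truncated generators are bounded uniformly in the truncation,
and converge uniformly on the plane when the truncation is removed. -/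
lemma exists_jumpGen_bound {r : ℝ} (hr : 0 < r) {γ : ℝ} (hγ : γ ∈ Ioo (-2 : ℝ) (-1))
    {β : Measure ℝ} [IsFiniteMeasure β] {φ : Plane → ℝ} {K : ℝ≥0} (hφ : LipschitzWith K φ) :
    ∃ A, 0 ≤ A ∧ (∀ v, Integrable (fun q : Plane × ℝ => ‖v - q.1‖ ^ γ *
        (φ (postVel v q.1 q.2) - φ v)) ((uniformCircle r).prod β)) ∧
      (∀ v, |jumpGen r β (fun x => x ^ γ) φ v| ≤ A) ∧
      (∀ δ > 0, ∀ v, |jumpGen r β (truncRate γ δ) φ v| ≤ A) ∧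
      (∀ δ > 0, ∀ v, |jumpGen r β (truncRate γ δ) φ v - jumpGen r β (fun x => x ^ γ) φ v|
        ≤ A * δ ^ (γ / 2 + 1)) := by
  obtain ⟨h1, h2⟩ := hγ
  obtain ⟨C₁, hC₁0, hC₁⟩ := exists_potential_bound hr (p := γ + 1) (by linarith) (by linarith)
  obtain ⟨C₂, hC₂0, hC₂⟩ := exists_potential_bound hr (p := γ / 2) (by linarith) (by linarith)
  have hpow : Measurable fun x : ℝ => x ^ γ := measurable_id.pow_const γ
  have hb₁ : ∀ x : ℝ, 0 ≤ x → |x ^ γ| * x ≤ 1 * x ^ (γ + 1) := fun x hx => by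
    rw [abs_of_nonneg (Real.rpow_nonneg hx _), one_mul]; exact rpow_mul_self_le hx
  have hb₂ : ∀ δ > 0, ∀ x : ℝ, 0 ≤ x → |truncRate γ δ x| * x ≤ 1 * x ^ (γ + 1) :=
    fun δ hδ x hx => by
      rw [abs_of_nonneg (truncRate_nonneg hδ _), one_mul]
      exact truncRate_mul_self_le (by linarith) hx
  have hb₃ : ∀ δ > 0, ∀ x : ℝ, 0 ≤ x → |truncRate γ δ x - x ^ γ| * x ≤
      δ ^ (γ / 2 + 1) * x ^ (γ / 2) :=
    fun δ hδ x hx => abs_truncRate_sub_mul_self_le (by linarith) (by linarith) hδ hx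
  have hi₁ := fun v => integrable_jump_of_lipschitz (β := β) hpow hb₁ zero_le_one hC₁ hφ v
  have hi₂ := fun δ hδ v => integrable_jump_of_lipschitz (β := β) (measurable_truncRate γ δ)
    (hb₂ δ hδ) zero_le_one hC₁ hφ v
  have hi₃ := fun δ (hδ : 0 < δ) v => integrable_jump_of_lipschitz (β := β)
    ((measurable_truncRate γ δ).sub hpow) (hb₃ δ hδ) (by positivity) hC₂ hφ v
  have e₁ : K * (1 * (β.real univ * C₁)) ≤ K * (1 * (β.real univ * (C₁ + C₂))) := by
    gcongr; linarith
  refine ⟨K * (1 * (β.real univ * (C₁ + C₂))), by positivity, fun v => (hi₁ v).1,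
    fun v => (hi₁ v).2.trans e₁, fun δ hδ v => (hi₂ δ hδ v).2.trans e₁, fun δ hδ v => ?_⟩
  have h3 := (hi₃ δ hδ v).2
  have h4 : jumpGen r β (truncRate γ δ) φ v - jumpGen r β (fun x => x ^ γ) φ v =
      jumpGen r β (truncRate γ δ - fun x => x ^ γ) φ v := by
    unfold jumpGen
    rw [← integral_sub (hi₂ δ hδ v).1 (hi₁ v).1]
    refine integral_congr_ae (Eventually.of_forall fun q => ?_)
    simp only [Pi.sub_apply]
    ring
  rw [h4]
  refine h3.trans ?_
  calc K * (δ ^ (γ / 2 + 1) * (β.real univ * C₂))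
      ≤ K * (δ ^ (γ / 2 + 1) * (β.real univ * (C₁ + C₂))) := by gcongr; linarith
    _ = _ := by ring

/-- The truncated generator preserves bounded Lipschitz functions. -/
lemma exists_lipschitzWith_jumpGen_truncRate (r : ℝ) {γ δ : ℝ} (hγ : γ ≤ 0) (hδ : 0 < δ)
    (β : Measure ℝ) [IsFiniteMeasure β] {φ : Plane → ℝ} {K : ℝ≥0} (hφ : LipschitzWith K φ)
    {M : ℝ} (hM : ∀ v, |φ v| ≤ M) : ∃ K', LipschitzWith K' (jumpGen r β (truncRate γ δ) φ) :=
  lipschitzWith_jumpGen (ρ := truncRate γ δ) (lipschitzWith_max_rpow (by linarith) hδ)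
    (fun x => by rw [abs_of_nonneg (truncRate_nonneg hδ x)]; exact truncRate_le hγ hδ x) hφ hM

lemma continuous_jumpGen_rpow {r : ℝ} (hr : 0 < r) {γ : ℝ} (hγ : γ ∈ Ioo (-2 : ℝ) (-1))
    {β : Measure ℝ} [IsFiniteMeasure β] {φ : Plane → ℝ} {K : ℝ≥0} (hφ : LipschitzWith K φ)
    {M : ℝ} (hM : ∀ v, |φ v| ≤ M) : Continuous (jumpGen r β (fun x => x ^ γ) φ) := by
  obtain ⟨A, hA, -, -, -, hd⟩ := exists_jumpGen_bound hr hγ (β := β) hφ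
  have hlim : Tendsto (fun δ : ℝ => A * δ ^ (γ / 2 + 1)) (𝓝[>] 0) (𝓝 0) := by
    have hpos : 0 < γ / 2 + 1 := by linarith [hγ.1]
    have h0 : Tendsto (fun δ : ℝ => A * δ ^ (γ / 2 + 1)) (𝓝 0) (𝓝 (A * 0 ^ (γ / 2 + 1))) :=
      ((Real.continuousAt_rpow_const 0 _ (Or.inr hpos.le)).tendsto).const_mul A
    rw [Real.zero_rpow hpos.ne', mul_zero] at h0
    exact h0.mono_left nhdsWithin_le_nhds
  refine continuous_of_uniform_approx_of_continuous fun u hu => ?_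
  obtain ⟨ε, hε, hu⟩ := Metric.mem_uniformity_dist.1 hu
  obtain ⟨δ, hδε, hδ⟩ := ((hlim.eventually (gt_mem_nhds hε)).and self_mem_nhdsWithin).exists
  obtain ⟨K', hK'⟩ := exists_lipschitzWith_jumpGen_truncRate r (γ := γ)
    (by linarith [hγ.2]) hδ β hφ hM
  refine ⟨_, hK'.continuous, fun v => hu ?_⟩
  rw [dist_comm, Real.dist_eq]
  exact (hd δ hδ v).trans_lt hδε

/-! ### The explicit Euler scheme -/

/-- The ball of radius `R` is stable under collisions with partners on the circle of radius `r`. -/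
def StableBall (r : ℝ) (β : Measure ℝ) (R : ℝ) : Prop :=
  ∀ᵐ θ ∂β, ∀ v w : Plane, ‖v‖ ≤ R → ‖w‖ = r → ‖postVel v w θ‖ ≤ R

/-- Probability measures on the plane, rotationally symmetric and carried by the ball of
radius `R`. -/
def IsRadialOn (R : ℝ) (μ : Measure Plane) : Prop :=
  IsProbabilityMeasure μ ∧ RotInvariant μ ∧ ∀ᵐ v ∂μ, ‖v‖ ≤ R

/-- Grazing collisions being excluded, `v ↦ v'` contracts by a factor bounded away from `1`, whence
a stable ball. -/
lemma exists_stableBall {r : ℝ} (hr : 0 < r) {β : Measure ℝ} (hβ : IsCrossSection β)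
    (hβ₀ : VanishesNearZero β) : ∃ R, r ≤ R ∧ StableBall r β R := by
  obtain ⟨θ₀, ⟨h0, h1⟩, hv⟩ := hβ₀
  have hπ := Real.pi_pos
  set c := Real.cos (θ₀ / 2) with hc
  have hc0 : 0 < c := Real.cos_pos_of_mem_Ioo ⟨by linarith, by linarith⟩
  have hc1 : c < 1 := by
    rw [hc, ← Real.cos_zero]
    exact Real.cos_lt_cos_of_nonneg_of_le_pi le_rfl (by linarith) (by linarith)
  have hR : c * (r / (1 - c)) + r = r / (1 - c) := by
    have : (1 - c) ≠ 0 := by linarith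
    field_simp; ring
  refine ⟨r / (1 - c), ?_, ?_⟩
  · rw [le_div_iff₀ (by linarith)]; nlinarith
  have hA : ∀ᵐ θ ∂β, θ ∈ Icc (-(Real.pi / 2)) (Real.pi / 2) \ {0} := hβ.carrier
  have hB : ∀ᵐ θ ∂β, θ ∉ Ioo (-θ₀) θ₀ := by
    rw [ae_iff]; simp only [not_not]; exact hv
  filter_upwards [hA, hB] with θ hθ hθ' v w hv hw
  refine (norm_postVel_le v w θ).trans ?_
  rw [hw, ← hR]
  have h2 : |Real.cos (θ / 2)| ≤ c := by
    have ha : θ₀ ≤ |θ| := by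
      by_contra h
      exact hθ' (abs_lt.1 (not_le.1 h))
    have hb : |θ| ≤ Real.pi / 2 := abs_le.2 ⟨hθ.1.1, hθ.1.2⟩
    rw [← Real.cos_abs, abs_div, abs_two, abs_of_nonneg]
    · exact Real.cos_le_cos_of_nonneg_of_le_pi (by linarith) (by linarith) (by linarith)
    · exact Real.cos_nonneg_of_mem_Icc ⟨by linarith [abs_nonneg θ], by linarith⟩
  gcongr

/-- One step of the explicit Euler scheme for a bounded rate: with a time step `h` small enough
for `1 - h L` to have nonnegative coefficients, it maps probability measures to probability
measures. -/
lemma exists_euler_step {r : ℝ} (hr : 0 ≤ r) {β : Measure ℝ} [IsFiniteMeasure β]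
    (hb : 0 < β.real univ) {ρ : ℝ → ℝ} (hρm : Measurable ρ) (hρ0 : ∀ x, 0 ≤ ρ x) {h : ℝ}
    (hh : 0 < h) (hρ : ∀ x, h * ρ x ≤ (β.real univ)⁻¹) {R : ℝ} (hR : StableBall r β R)
    {μ : Measure Plane} (hμ : IsRadialOn R μ) :
    ∃ μ' : Measure Plane, IsRadialOn R μ' ∧ ∀ φ : Plane → ℝ, Continuous φ →
      ∀ M, (∀ v, |φ v| ≤ M) → ∫ v, φ v ∂μ' = ∫ v, φ v ∂μ + h * ∫ v, jumpGen r β ρ φ v ∂μ := by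
  obtain ⟨hμp, hμr, hμR⟩ := hμ
  set b := β.real univ with hbdef
  set m : Measure (Plane × (Plane × ℝ)) := μ.prod ((uniformCircle r).prod β) with hm
  have hfst : Measurable fun p : Plane × (Plane × ℝ) => p.1 := measurable_fst
  have hdist : Measurable fun p : Plane × (Plane × ℝ) => h * ρ ‖p.1 - p.2.1‖ := by
    have : Continuous fun p : Plane × (Plane × ℝ) => ‖p.1 - p.2.1‖ := by fun_prop
    exact (hρm.comp this.measurable).const_mul h
  have hpost : Measurable fun p : Plane × (Plane × ℝ) => postVel p.1 p.2.1 p.2.2 :=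
    continuous_postVel.measurable
  set g : Plane × (Plane × ℝ) → ℝ := fun p => h * ρ ‖p.1 - p.2.1‖ with hg
  have hg0 : ∀ p, 0 ≤ g p := fun p => mul_nonneg hh.le (hρ0 _)
  have hg1 : ∀ p, 0 ≤ b⁻¹ - g p := fun p => sub_nonneg.2 (hρ _)
  have hmu : m univ = ENNReal.ofReal b := by
    rw [hm, ← univ_prod_univ, Measure.prod_prod, ← univ_prod_univ, Measure.prod_prod]
    simp [hbdef, Measure.real]
  set m₁ := m.withDensity fun p => ENNReal.ofReal (g p) with hm₁
  set m₂ := m.withDensity fun p => ENNReal.ofReal (b⁻¹ - g p) with hm₂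
  have hmass : m₁ univ + m₂ univ = 1 := by
    rw [hm₁, hm₂, withDensity_apply _ MeasurableSet.univ, withDensity_apply _ MeasurableSet.univ,
      ← lintegral_add_left hdist.ennreal_ofReal]
    have : ∀ p, ENNReal.ofReal (g p) + ENNReal.ofReal (b⁻¹ - g p) = ENNReal.ofReal b⁻¹ := fun p => by
      rw [← ENNReal.ofReal_add (hg0 p) (hg1 p)]; congr 1; ring
    simp only [this, Measure.restrict_univ, lintegral_const, hmu]
    rw [← ENNReal.ofReal_mul (by positivity), inv_mul_cancel₀ hb.ne', ENNReal.ofReal_one]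
  have hf₁ : IsFiniteMeasure m₁ := ⟨lt_of_le_of_lt (le_self_add.trans hmass.le) ENNReal.one_lt_top⟩
  have hf₂ : IsFiniteMeasure m₂ := ⟨lt_of_le_of_lt (le_add_self.trans hmass.le) ENNReal.one_lt_top⟩
  set μ' := m₁.map (fun p => postVel p.1 p.2.1 p.2.2) + m₂.map (fun p => p.1) with hμ'
  have hp : IsProbabilityMeasure μ' := by
    constructor
    rw [hμ', Measure.add_apply, Measure.map_apply hpost MeasurableSet.univ,
      Measure.map_apply hfst MeasurableSet.univ]
    exact hmass
  have hform : ∀ φ : Plane → ℝ, Continuous φ →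
      ∀ M, (∀ v, |φ v| ≤ M) → ∫ v, φ v ∂μ' = ∫ v, φ v ∂μ + h * ∫ v, jumpGen r β ρ φ v ∂μ := by
    intro φ hφ M hM
    have hi₁ : Integrable (fun p => φ (postVel p.1 p.2.1 p.2.2)) m₁ :=
      Integrable.of_bound (hφ.measurable.comp hpost).aestronglyMeasurable M
        (Eventually.of_forall fun p => hM _)
    have hi₂ : Integrable (fun p : Plane × (Plane × ℝ) => φ p.1) m₂ :=
      Integrable.of_bound (hφ.measurable.comp hfst).aestronglyMeasurable M
        (Eventually.of_forall fun p => hM _)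
    have hi₃ : Integrable (fun p : Plane × (Plane × ℝ) => φ p.1) m :=
      Integrable.of_bound (hφ.measurable.comp hfst).aestronglyMeasurable M
        (Eventually.of_forall fun p => hM _)
    have hi₄ : Integrable (fun p : Plane × (Plane × ℝ) => ρ ‖p.1 - p.2.1‖ *
        (φ (postVel p.1 p.2.1 p.2.2) - φ p.1)) m := by
      have h1 : Integrable (fun p : Plane × (Plane × ℝ) => h⁻¹ * (g p *
        (φ (postVel p.1 p.2.1 p.2.2) - φ p.1))) m := by
        refine (Integrable.of_bound (hdist.mul ((hφ.measurable.comp hpost).sub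
          (hφ.measurable.comp hfst))).aestronglyMeasurable (b⁻¹ * (M + M))
          (Eventually.of_forall fun p => ?_)).const_mul _
        rw [Real.norm_eq_abs, Pi.mul_apply, abs_mul, abs_of_nonneg (hg0 p)]
        gcongr
        · exact hρ _
        · exact (abs_sub _ _).trans (add_le_add (hM _) (hM _))
      refine h1.congr (Eventually.of_forall fun p => ?_)
      simp only [hg]
      field_simp
    have hi₅ := hi₄.const_mul h
    rw [hμ', integral_add_measure
      ((integrable_map_measure hφ.aestronglyMeasurable hpost.aemeasurable).2 hi₁)
      ((integrable_map_measure hφ.aestronglyMeasurable hfst.aemeasurable).2 hi₂),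
      integral_map hpost.aemeasurable hφ.aestronglyMeasurable,
      integral_map hfst.aemeasurable hφ.aestronglyMeasurable, hm₁, hm₂,
      integral_withDensity_eq_integral_toReal_smul hdist.ennreal_ofReal
        (Eventually.of_forall fun p => ENNReal.ofReal_lt_top),
      integral_withDensity_eq_integral_toReal_smul (hdist.const_sub _).ennreal_ofReal
        (Eventually.of_forall fun p => ENNReal.ofReal_lt_top)]
    rw [hm₁, integrable_withDensity_iff_integrable_smul' hdist.ennreal_ofReal
      (Eventually.of_forall fun p => ENNReal.ofReal_lt_top)] at hi₁
    rw [hm₂, integrable_withDensity_iff_integrable_smul' (hdist.const_sub _).ennreal_ofReal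
      (Eventually.of_forall fun p => ENNReal.ofReal_lt_top)] at hi₂
    rw [← integral_add hi₁ hi₂]
    have e1 : ∫ v, φ v ∂μ = b⁻¹ * ∫ p, φ p.1 ∂m := by
      rw [hm, integral_fun_fst φ, smul_eq_mul, ← mul_assoc]
      have : ((uniformCircle r).prod β).real univ = b := by
        rw [← univ_prod_univ, measureReal_prod_prod]; simp [hbdef]
      rw [this, inv_mul_cancel₀ hb.ne', one_mul]
    have e2 : ∫ v, jumpGen r β ρ φ v ∂μ = ∫ p : Plane × (Plane × ℝ), ρ ‖p.1 - p.2.1‖ *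
        (φ (postVel p.1 p.2.1 p.2.2) - φ p.1) ∂m := by
      rw [hm, integral_prod _ hi₄]; rfl
    rw [e1, e2, ← integral_const_mul, ← integral_const_mul, ← integral_add (hi₃.const_mul _) hi₅]
    refine integral_congr_ae (Eventually.of_forall fun p => ?_)
    simp only [ENNReal.toReal_ofReal (hg0 p), ENNReal.toReal_ofReal (hg1 p), smul_eq_mul]
    simp only [hg]
    ring
  refine ⟨μ', ⟨hp, ?_, ?_⟩, hform⟩
  · refine rotInvariant_of_integral fun η φ => ?_
    have hM := φ.norm_coe_le_norm
    rw [hform φ φ.continuous ‖φ‖ hM, hform (fun v => φ (rot η v))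
      (φ.continuous.comp (continuous_rot η)) ‖φ‖ (fun v => hM _), hμr.integral_comp η φ]
    congr 2
    rw [← hμr.integral_comp η (jumpGen r β ρ φ)]
    exact integral_congr_ae (Eventually.of_forall fun v => (jumpGen_rot r β ρ φ η v).symm)
  · have hball : MeasurableSet {v : Plane | ‖v‖ ≤ R} :=
      measurableSet_le measurable_norm measurable_const
    have a1 : ∀ᵐ p ∂m, ‖p.1‖ ≤ R := Measure.quasiMeasurePreserving_fst.ae hμR
    have a2 : ∀ᵐ p ∂m, ‖p.2.1‖ = r :=
      (Measure.quasiMeasurePreserving_fst.comp Measure.quasiMeasurePreserving_snd).ae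
        (ae_norm_uniformCircle hr)
    have a3 : ∀ᵐ p ∂m, ∀ v w : Plane, ‖v‖ ≤ R → ‖w‖ = r → ‖postVel v w p.2.2‖ ≤ R :=
      (Measure.quasiMeasurePreserving_snd.comp Measure.quasiMeasurePreserving_snd).ae hR
    rw [hμ', ae_add_measure_iff, ae_map_iff hpost.aemeasurable hball,
      ae_map_iff hfst.aemeasurable hball]
    refine ⟨(withDensity_absolutelyContinuous _ _).ae_le ?_,
      (withDensity_absolutelyContinuous _ _).ae_le a1⟩
    filter_upwards [a1, a2, a3] with p h1 h2 h3 using h3 _ _ h1 h2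

/-- Euler schemes for the rates truncated at `δ n`, with time steps `h n`, both tending to `0`. The
choice `δ = 1 / (n + 1)`, `h = δ ^ 2 / (β univ + 1)` makes `h * δ ^ γ * β univ ≤ 1`, as
`γ > -2`. -/
lemma exists_euler_chain {r : ℝ} (hr : 0 ≤ r) {γ : ℝ} (hγ : γ ∈ Ioo (-2 : ℝ) (-1))
    {β : Measure ℝ} [IsFiniteMeasure β] (hb : 0 < β.real univ) {R : ℝ} (hrR : r ≤ R)
    (hR : StableBall r β R) :
    ∃ (δ h : ℕ → ℝ) (μ : ℕ → ℕ → Measure Plane), (∀ n, 0 < δ n) ∧ Tendsto δ atTop (𝓝 0) ∧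
      (∀ n, 0 < h n) ∧ Tendsto h atTop (𝓝 0) ∧
      (∀ n k, IsRadialOn R (μ n k)) ∧ (∀ n, μ n 0 = uniformCircle r) ∧
      ∀ n k, ∀ φ : Plane → ℝ, Continuous φ → ∀ M, (∀ v, |φ v| ≤ M) →
        ∫ v, φ v ∂(μ n (k + 1)) = ∫ v, φ v ∂(μ n k) +
          h n * ∫ v, jumpGen r β (truncRate γ (δ n)) φ v ∂(μ n k) := by
  obtain ⟨h1, h2⟩ := hγ
  set b := β.real univ with hbdef
  set δ : ℕ → ℝ := fun n => 1 / ((n : ℝ) + 1) with hδ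
  have hδ0 : ∀ n, 0 < δ n := fun n => by positivity
  have hδ1 : ∀ n, δ n ≤ 1 := fun n => by
    rw [hδ]; simp only; rw [div_le_one (by positivity)]
    linarith [Nat.cast_nonneg (α := ℝ) n]
  have hδlim : Tendsto δ atTop (𝓝 0) := tendsto_one_div_add_atTop_nhds_zero_nat
  set h : ℕ → ℝ := fun n => δ n ^ 2 / (b + 1) with hh
  have hh0 : ∀ n, 0 < h n := fun n => div_pos (pow_pos (hδ0 n) 2) (by positivity)
  have hhlim : Tendsto h atTop (𝓝 0) := by
    have := (hδlim.pow 2).div_const (b + 1)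
    simpa using this
  have hstep : ∀ n x, h n * truncRate γ (δ n) x ≤ b⁻¹ := fun n x => by
    calc h n * truncRate γ (δ n) x ≤ h n * δ n ^ γ :=
          mul_le_mul_of_nonneg_left (truncRate_le (by linarith) (hδ0 n) x) (hh0 n).le
      _ = δ n ^ (2 + γ) / (b + 1) := by
          rw [hh, Real.rpow_add (hδ0 n)]; simp only [Real.rpow_ofNat]; ring
      _ ≤ 1 / (b + 1) := by
          gcongr; exact Real.rpow_le_one (hδ0 n).le (hδ1 n) (by linarith)
      _ ≤ b⁻¹ := by rw [← one_div]; gcongr; linarith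
  have step : ∀ n (μ : {μ : Measure Plane // IsRadialOn R μ}),
      ∃ μ' : {μ : Measure Plane // IsRadialOn R μ}, ∀ φ : Plane → ℝ, Continuous φ →
      ∀ M, (∀ v, |φ v| ≤ M) → ∫ v, φ v ∂μ'.1 = ∫ v, φ v ∂μ.1 +
        h n * ∫ v, jumpGen r β (truncRate γ (δ n)) φ v ∂μ.1 := fun n μ => by
    obtain ⟨μ', hμ', h'⟩ := exists_euler_step hr hb (measurable_truncRate γ (δ n))
      (truncRate_nonneg (hδ0 n)) (hh0 n) (hstep n) hR μ.2
    exact ⟨⟨μ', hμ'⟩, h'⟩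
  choose T hT using step
  have h0 : IsRadialOn R (uniformCircle r) := ⟨inferInstance, rotInvariant_uniformCircle r,
    (ae_norm_uniformCircle hr).mono fun v hv => hv.trans_le hrR⟩
  exact ⟨δ, h, fun n k => ((T n)^[k] ⟨_, h0⟩).1, hδ0, hδlim, hh0, hhlim, fun n k => Subtype.prop _,
    fun n => rfl, fun n k => by
      simp only [Function.iterate_succ_apply']
      exact hT n _⟩

/-! ### Passage to the limit -/

/-- Measures carried by a fixed ball are tight, hence converge weakly along any ultrafilter. -/
lemma exists_limit_isRadialOn {R : ℝ} {ν : ℕ → Measure Plane} (hν : ∀ n, IsRadialOn R (ν n)) :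
    ∃ μ, IsRadialOn R μ ∧ ∀ φ : Plane → ℝ, Continuous φ → ∀ M, (∀ v, |φ v| ≤ M) →
      Tendsto (fun n => ∫ v, φ v ∂(ν n)) (hyperfilter ℕ) (𝓝 (∫ v, φ v ∂μ)) := by
  set P : ℕ → ProbabilityMeasure Plane := fun n => ⟨ν n, (hν n).1⟩ with hP
  have htight : IsTightMeasureSet {((μ : ProbabilityMeasure Plane) : Measure Plane) |
      μ ∈ range P} := by
    rw [isTightMeasureSet_iff_exists_isCompact_measure_compl_le]
    intro ε hε
    refine ⟨Metric.closedBall 0 R, isCompact_closedBall 0 R, ?_⟩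
    rintro _ ⟨_, ⟨n, rfl⟩, rfl⟩
    have : (ν n) (Metric.closedBall 0 R)ᶜ = 0 := by
      have h1 : ∀ᵐ v ∂(ν n), v ∈ Metric.closedBall (0 : Plane) R := by
        filter_upwards [(hν n).2.2] with v hv
        simpa using hv
      exact h1
    change (ν n) (Metric.closedBall 0 R)ᶜ ≤ ε
    rw [this]; exact zero_le
  obtain ⟨μ, -, hμ⟩ := (isCompact_closure_of_isTightMeasureSet htight).ultrafilter_le_nhds'
    ((hyperfilter ℕ).map P) (by
      rw [Ultrafilter.mem_map]
      exact Filter.univ_mem' fun n => subset_closure (mem_range_self n))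
  have hlim : Tendsto P (hyperfilter ℕ) (𝓝 μ) := hμ
  rw [ProbabilityMeasure.tendsto_iff_forall_integral_tendsto] at hlim
  have hlim' : ∀ φ : Plane → ℝ, Continuous φ → ∀ M, (∀ v, |φ v| ≤ M) →
      Tendsto (fun n => ∫ v, φ v ∂(ν n)) (hyperfilter ℕ) (𝓝 (∫ v, φ v ∂(μ : Measure Plane))) :=
    fun φ hφ M hM => hlim (BoundedContinuousFunction.ofNormedAddCommGroup φ hφ M hM)
  refine ⟨μ, ⟨inferInstance, ?_, ?_⟩, hlim'⟩
  · refine rotInvariant_of_integral fun η φ => ?_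
    refine tendsto_nhds_unique (hlim' (fun v => φ (rot η v)) (φ.continuous.comp (continuous_rot η))
      ‖φ‖ fun v => φ.norm_coe_le_norm _) ?_
    simp only [fun n => (hν n).2.1.integral_comp η φ]
    exact hlim' φ φ.continuous ‖φ‖ φ.norm_coe_le_norm
  · set χ : Plane → ℝ := fun v => min 1 (max 0 (‖v‖ - R)) with hχ
    have hχ0 : ∀ v, 0 ≤ χ v := fun v => le_min zero_le_one (le_max_left _ _)
    have hχ1 : ∀ v, |χ v| ≤ 1 := fun v => by rw [abs_of_nonneg (hχ0 v)]; exact min_le_left _ _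
    have hχc : Continuous χ := by fun_prop
    have h1 := hlim' χ hχc 1 hχ1
    have h2 : ∀ n, ∫ v, χ v ∂(ν n) = 0 := fun n => by
      refine integral_eq_zero_of_ae ?_
      filter_upwards [(hν n).2.2] with v hv
      simp [hχ, hv]
    simp only [h2] at h1
    have h3 : ∫ v, χ v ∂(μ : Measure Plane) = 0 :=
      tendsto_nhds_unique h1 tendsto_const_nhds
    rw [integral_eq_zero_iff_of_nonneg hχ0 (Integrable.of_bound hχc.aestronglyMeasurable 1
      (Eventually.of_forall hχ1))] at h3
    filter_upwards [h3] with v hv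
    by_contra h
    push Not at h
    have : 0 < χ v := lt_min one_pos (lt_max_of_lt_right (by linarith))
    simp only [Pi.zero_apply] at hv
    linarith

lemma continuousOn_of_approx {w : ℝ → ℝ} (hw : ∀ η > 0, ∃ A, ∀ s t, 0 ≤ s → s ≤ t →
    |w t - w s| ≤ η + A * (t - s)) : ContinuousOn w (Ici 0) := by
  intro s hs
  rw [ContinuousWithinAt, Metric.tendsto_nhdsWithin_nhds]
  intro ε hε
  obtain ⟨A, hA⟩ := hw (ε / 2) (by positivity)
  refine ⟨ε / (2 * (|A| + 1)), by positivity, fun {t} ht hts => ?_⟩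
  rw [Real.dist_eq] at hts ⊢
  have h1 : |w t - w s| ≤ ε / 2 + |A| * |t - s| := by
    rcases le_total s t with h | h
    · refine (hA s t hs h).trans ?_
      rw [abs_of_nonneg (sub_nonneg.2 h)]
      gcongr
      exact le_abs_self A
    · rw [abs_sub_comm, abs_sub_comm t s]
      refine (hA t s ht h).trans ?_
      rw [abs_of_nonneg (sub_nonneg.2 h)]
      gcongr
      exact le_abs_self A
  rw [lt_div_iff₀ (by positivity)] at hts
  nlinarith [abs_nonneg A, abs_nonneg (t - s)]

/-- A fundamental theorem of calculus for a function `u` whose increments are compared with those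
of its candidate derivative `w` up to an arbitrarily small relative error. -/
lemma integral_eq_of_approx {u w : ℝ → ℝ}
    (hc : ∀ η > 0, ∃ A, ∀ s t, 0 ≤ s → s ≤ t → |u t - u s| ≤ η + A * (t - s))
    (hw : ∀ η > 0, ∃ A, ∀ s t, 0 ≤ s → s ≤ t → |w t - w s| ≤ η + A * (t - s))
    (hu : ∀ η > 0, ∃ A, ∀ s t, 0 ≤ s → s ≤ t →
      |u t - u s - (t - s) * w s| ≤ (t - s) * (η + A * (t - s))) {t : ℝ} (ht : 0 ≤ t) :
    IntervalIntegrable w volume 0 t ∧ u t = u 0 + ∫ s in (0 : ℝ)..t, w s := by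
  have hsub : uIcc 0 t ⊆ Ici 0 := by rw [uIcc_of_le ht]; exact fun s hs => hs.1
  have hi : IntervalIntegrable w volume 0 t :=
    ((continuousOn_of_approx hw).mono hsub).intervalIntegrable
  refine ⟨hi, ?_⟩
  rw [intervalIntegral.integral_eq_sub_of_hasDeriv_right (f := u)
    ((continuousOn_of_approx hc).mono hsub) (fun s hs => ?_) hi]
  · ring
  rw [min_eq_left ht] at hs
  rw [hasDerivWithinAt_iff_isLittleO, Asymptotics.isLittleO_iff]
  intro c hc'
  obtain ⟨A, hA⟩ := hu (c / 2) (by positivity)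
  have h1 : ∀ᶠ x in 𝓝[>] s, A * (x - s) < c / 2 := by
    have : Tendsto (fun x => A * (x - s)) (𝓝 s) (𝓝 (A * (s - s))) := by
      exact (Continuous.tendsto (by fun_prop) s)
    rw [sub_self, mul_zero] at this
    exact (this.mono_left nhdsWithin_le_nhds).eventually (gt_mem_nhds (by positivity))
  filter_upwards [h1, self_mem_nhdsWithin] with x hx hsx
  have hsx' : s < x := hsx
  rw [smul_eq_mul, Real.norm_eq_abs, Real.norm_eq_abs, abs_of_pos (sub_pos.2 hsx'), mul_comm c]
  refine (hA s x hs.1.le hsx'.le).trans ?_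
  exact mul_le_mul_of_nonneg_left (by linarith) (sub_pos.2 hsx').le

lemma tendsto_mul_floor {h : ℕ → ℝ} (hh : ∀ n, 0 < h n) (hlim : Tendsto h atTop (𝓝 0)) {t : ℝ}
    (ht : 0 ≤ t) : Tendsto (fun n => h n * (⌊t / h n⌋₊ : ℝ)) atTop (𝓝 t) := by
  have h1 : Tendsto (fun n => t - h n) atTop (𝓝 t) := by simpa using hlim.const_sub t
  refine tendsto_of_tendsto_of_tendsto_of_le_of_le h1 tendsto_const_nhds (fun n => ?_) fun n => ?_
  · have := Nat.lt_floor_add_one (t / h n)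
    rw [div_lt_iff₀ (hh n)] at this
    simp only; nlinarith
  · have := Nat.floor_le (div_nonneg ht (hh n).le)
    rw [le_div_iff₀ (hh n)] at this
    simp only; linarith

lemma abs_chain_sub_le {ℓ g : ℕ → ℝ} {h A : ℝ} (hh : 0 ≤ h)
    (hstep : ∀ k, ℓ (k + 1) = ℓ k + h * g k) (hg : ∀ k, |g k| ≤ A) (k i : ℕ) :
    |ℓ (k + i) - ℓ k| ≤ A * (h * i) := by
  induction i with
  | zero => simp
  | succ i ih =>
    rw [← add_assoc, hstep]
    have h1 : |h * g (k + i)| ≤ h * A := by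
      rw [abs_mul, abs_of_nonneg hh]; exact mul_le_mul_of_nonneg_left (hg _) hh
    have h2 := abs_add_le (ℓ (k + i) - ℓ k) (h * g (k + i))
    rw [show ℓ (k + i) + h * g (k + i) - ℓ k = ℓ (k + i) - ℓ k + h * g (k + i) by ring]
    push_cast
    linarith

/-- First order expansion of an Euler scheme with increments `h * g k`, when `g` is close to a
sequence `w` of small increments. -/
lemma abs_chain_sub_sub_le {ℓ g w : ℕ → ℝ} {h B η A : ℝ} (hh : 0 ≤ h) (hA : 0 ≤ A)
    (hstep : ∀ k, ℓ (k + 1) = ℓ k + h * g k) (hg : ∀ k, |g k - w k| ≤ B)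
    (hw : ∀ k i : ℕ, |w (k + i) - w k| ≤ η + A * (h * i)) (k i : ℕ) :
    |ℓ (k + i) - ℓ k - (h * i) * w k| ≤ (h * i) * (B + η + A * (h * i)) := by
  induction i with
  | zero => simp
  | succ i ih =>
    rw [← add_assoc, hstep]
    have h1 : |h * (g (k + i) - w k)| ≤ h * (B + η + A * (h * i)) := by
      rw [abs_mul, abs_of_nonneg hh]
      refine mul_le_mul_of_nonneg_left ?_ hh
      have := abs_add_le (g (k + i) - w (k + i)) (w (k + i) - w k)
      rw [sub_add_sub_cancel] at this
      linarith [hg (k + i), hw k i]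
    have h2 := abs_add_le (ℓ (k + i) - ℓ k - (h * i) * w k) (h * (g (k + i) - w k))
    rw [show ℓ (k + i) + h * g (k + i) - ℓ k - h * ((i + 1 : ℕ) : ℝ) * w k =
      ℓ (k + i) - ℓ k - (h * i) * w k + h * (g (k + i) - w k) by push_cast; ring]
    refine h2.trans ((add_le_add ih h1).trans ?_)
    push_cast
    have h3 : 0 ≤ (h * (i + 1)) * (A * h) := by positivity
    nlinarith

/-- Limits of the Euler schemes solve the weak equation against bounded Lipschitz functions. The
limit is taken along an ultrafilter, separately at each time; the time integral is recovered by
passing to the limit in the increments rather than under the integral sign. -/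
lemma exists_radial_evolution {r : ℝ} (hr : 0 < r) {γ : ℝ} (hγ : γ ∈ Ioo (-2 : ℝ) (-1))
    {β : Measure ℝ} [IsFiniteMeasure β] (hb : 0 < β.real univ) {R : ℝ} (hrR : r ≤ R)
    (hR : StableBall r β R) :
    ∃ f : ℝ → Measure Plane, (∀ t, IsRadialOn R (f t)) ∧
      ∀ φ : Plane → ℝ, (∃ K, LipschitzWith K φ) → ∀ M, (∀ v, |φ v| ≤ M) → ∀ t, 0 ≤ t →
        IntervalIntegrable (fun s => ∫ v, jumpGen r β (fun x => x ^ γ) φ v ∂(f s)) volume 0 t ∧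
        ∫ v, φ v ∂(f t) = ∫ v, φ v ∂(uniformCircle r) +
          ∫ s in (0 : ℝ)..t, ∫ v, jumpGen r β (fun x => x ^ γ) φ v ∂(f s) := by
  obtain ⟨δ, h, μ, hδ, hδlim, hh, hhlim, hμ, hμ0, hstep⟩ :=
    exists_euler_chain hr.le hγ hb hrR hR
  have hlim := fun t : ℝ => exists_limit_isRadialOn fun n => hμ n ⌊t / h n⌋₊
  choose f hf hconv using hlim
  have hprob : ∀ n k, IsProbabilityMeasure (μ n k) := fun n k => (hμ n k).1
  have hfprob : ∀ t, IsProbabilityMeasure (f t) := fun t => (hf t).1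
  have hf0 : ∀ φ : Plane → ℝ, Continuous φ → ∀ M, (∀ v, |φ v| ≤ M) →
      ∫ v, φ v ∂(f 0) = ∫ v, φ v ∂(uniformCircle r) := fun φ hφ M hM => by
    have h1 := hconv 0 φ hφ M hM
    simp only [zero_div, Nat.floor_zero, hμ0] at h1
    exact tendsto_nhds_unique h1 tendsto_const_nhds
  -- the number of steps between two times, in units of time
  have hsteps : ∀ s t, 0 ≤ s → s ≤ t → Tendsto (fun n =>
      h n * ((⌊t / h n⌋₊ - ⌊s / h n⌋₊ : ℕ) : ℝ)) (hyperfilter ℕ) (𝓝 (t - s)) := by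
    intro s t hs hst
    have h1 := (tendsto_mul_floor hh hhlim (hs.trans hst)).sub (tendsto_mul_floor hh hhlim hs)
    refine (h1.congr fun n => ?_).mono_left Nat.hyperfilter_le_atTop
    rw [Nat.cast_sub, mul_sub]
    exact Nat.floor_mono (div_le_div_of_nonneg_right hst (hh n).le)
  have hadd : ∀ s t n, s ≤ t →
      ⌊s / h n⌋₊ + (⌊t / h n⌋₊ - ⌊s / h n⌋₊) = ⌊t / h n⌋₊ := fun s t n hst =>
    Nat.add_sub_cancel' (Nat.floor_mono (div_le_div_of_nonneg_right hst (hh n).le))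
  have hint : ∀ {ν : Measure Plane} [IsProbabilityMeasure ν] {φ : Plane → ℝ} {M : ℝ},
      Continuous φ → (∀ v, |φ v| ≤ M) → Integrable φ ν := fun hφ hM =>
    Integrable.of_bound hφ.aestronglyMeasurable _ (Eventually.of_forall hM)
  have habs : ∀ {ν : Measure Plane} [IsProbabilityMeasure ν] {φ : Plane → ℝ} {M : ℝ},
      (∀ v, |φ v| ≤ M) → |∫ v, φ v ∂ν| ≤ M := fun {ν _ φ M} hM => by
    simpa using norm_integral_le_of_norm_le_const (μ := ν) (f := φ) (Eventually.of_forall hM)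
  refine ⟨f, hf, fun φ ⟨K, hφ⟩ M hM => ?_⟩
  -- increments of bounded Lipschitz observables along the schemes
  have hincr : ∀ ψ : Plane → ℝ, (∃ K, LipschitzWith K ψ) → (∃ M, ∀ v, |ψ v| ≤ M) →
      ∃ A, 0 ≤ A ∧ ∀ n k i, |∫ v, ψ v ∂(μ n (k + i)) - ∫ v, ψ v ∂(μ n k)| ≤ A * (h n * i) := by
    rintro ψ ⟨K, hψ⟩ ⟨M, hM⟩
    obtain ⟨A, hA, -, -, hA', -⟩ := exists_jumpGen_bound hr hγ (β := β) hψ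
    exact ⟨A, hA, fun n => abs_chain_sub_le (ℓ := fun k => ∫ v, ψ v ∂(μ n k)) (hh n).le
      (fun k => hstep n k ψ hψ.continuous M hM) fun k => habs (hA' _ (hδ n))⟩
  obtain ⟨A, hA, hjint, hjb, htb, htd⟩ := exists_jumpGen_bound hr hγ (β := β) hφ
  set g := jumpGen r β (fun x => x ^ γ) φ with hg
  have hgc : Continuous g := continuous_jumpGen_rpow hr hγ hφ hM
  have hq : 0 < γ / 2 + 1 := by linarith [hγ.1]
  have hqlim : Tendsto (fun x : ℝ => A * x ^ (γ / 2 + 1)) (𝓝 0) (𝓝 0) := by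
    have h0 : Tendsto (fun x : ℝ => A * x ^ (γ / 2 + 1)) (𝓝 0) (𝓝 (A * 0 ^ (γ / 2 + 1))) :=
      ((Real.continuousAt_rpow_const 0 _ (Or.inr hq.le)).tendsto).const_mul A
    rwa [Real.zero_rpow hq.ne', mul_zero] at h0
  -- increments of the generator, compared with a Lipschitz truncation
  have hgincr : ∀ η > 0, ∃ A', 0 ≤ A' ∧ ∀ n k i,
      |∫ v, g v ∂(μ n (k + i)) - ∫ v, g v ∂(μ n k)| ≤ η + A' * (h n * i) := by
    intro η hη
    obtain ⟨d, hdη, hd⟩ := (((hqlim.mono_left nhdsWithin_le_nhds).eventually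
      (gt_mem_nhds (half_pos hη))).and (self_mem_nhdsWithin (s := Ioi (0 : ℝ)))).exists
    obtain ⟨K', hK'⟩ := exists_lipschitzWith_jumpGen_truncRate r (γ := γ)
      (by linarith [hγ.2]) hd β hφ hM
    obtain ⟨A', hA', hi⟩ := hincr _ ⟨K', hK'⟩ ⟨A, htb d hd⟩
    refine ⟨A', hA', fun n k i => ?_⟩
    have hclose : ∀ n k, |∫ v, jumpGen r β (truncRate γ d) φ v ∂(μ n k) - ∫ v, g v ∂(μ n k)|
        ≤ η / 2 := fun n k => by
      rw [← integral_sub (hint hK'.continuous (htb d hd)) (hint hgc hjb)]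
      exact habs fun v => (htd d hd v).trans hdη.le
    have h1 := abs_le.1 (hclose n (k + i))
    have h2 := abs_le.1 (hclose n k)
    have h3 := abs_le.1 (hi n k i)
    rw [abs_le]
    constructor <;> linarith
  have hlimφ := fun t => hconv t φ hφ.continuous M hM
  have hlimg := fun t => hconv t g hgc A hjb
  intro t ht
  have key := integral_eq_of_approx (u := fun t => ∫ v, φ v ∂(f t))
    (w := fun t => ∫ v, g v ∂(f t)) ?_ ?_ ?_ ht
  · rw [hf0 φ hφ.continuous M hM] at key
    exact key
  · intro η hη
    obtain ⟨B, hB, hi⟩ := hincr φ ⟨K, hφ⟩ ⟨M, hM⟩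
    refine ⟨B, fun s t hs hst => ?_⟩
    have h1 : |∫ v, φ v ∂(f t) - ∫ v, φ v ∂(f s)| ≤ B * (t - s) :=
      le_of_tendsto_of_tendsto ((hlimφ t).sub (hlimφ s)).abs ((hsteps s t hs hst).const_mul B)
        (Eventually.of_forall fun n => by
          have := hi n ⌊s / h n⌋₊ (⌊t / h n⌋₊ - ⌊s / h n⌋₊)
          rwa [hadd s t n hst] at this)
    linarith
  · intro η hη
    obtain ⟨B, hB, hi⟩ := hgincr η hη
    refine ⟨B, fun s t hs hst => ?_⟩
    exact le_of_tendsto_of_tendsto ((hlimg t).sub (hlimg s)).abs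
      (((hsteps s t hs hst).const_mul B).const_add η)
      (Eventually.of_forall fun n => by
        have := hi n ⌊s / h n⌋₊ (⌊t / h n⌋₊ - ⌊s / h n⌋₊)
        rwa [hadd s t n hst] at this)
  · intro η hη
    obtain ⟨B, hB, hi⟩ := hgincr η hη
    refine ⟨B, fun s t hs hst => ?_⟩
    have hd0 : Tendsto (fun n => A * δ n ^ (γ / 2 + 1)) (hyperfilter ℕ) (𝓝 0) :=
      (hqlim.comp hδlim).mono_left Nat.hyperfilter_le_atTop
    have hst' := hsteps s t hs hst
    have hR := hst'.mul ((hd0.add_const η).add (hst'.const_mul B))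
    rw [zero_add] at hR
    refine le_of_tendsto_of_tendsto
      (((hlimφ t).sub (hlimφ s)).sub (hst'.mul (hlimg s))).abs hR
      (Eventually.of_forall fun n => ?_)
    have := abs_chain_sub_sub_le (ℓ := fun k => ∫ v, φ v ∂(μ n k)) (hh n).le hB (fun k => hstep n k φ hφ.continuous M hM)
      (w := fun k => ∫ v, g v ∂(μ n k)) (B := A * δ n ^ (γ / 2 + 1)) (fun k => ?_) (hi n)
      ⌊s / h n⌋₊ (⌊t / h n⌋₊ - ⌊s / h n⌋₊)
    · rwa [hadd s t n hst] at this
    · obtain ⟨K', hK'⟩ := exists_lipschitzWith_jumpGen_truncRate r (γ := γ)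
        (by linarith [hγ.2]) (hδ n) β hφ hM
      rw [← integral_sub (hint hK'.continuous (htb _ (hδ n))) (hint hgc hjb)]
      exact habs fun v => htd _ (hδ n) v

/-! ### Existence of a rotationally symmetric solution -/

lemma IsCrossSection.isFiniteMeasure {β : Measure ℝ} (hβ : IsCrossSection β) :
    IsFiniteMeasure β := ⟨hβ.mass_lt_top⟩

lemma IsCrossSection.real_univ_pos {β : Measure ℝ} (hβ : IsCrossSection β) :
    0 < β.real univ := ENNReal.toReal_pos hβ.mass_pos.ne' hβ.mass_lt_top.ne

lemma measurable_collision {γ : ℝ} {β : Measure ℝ} (hβ : IsCrossSection β) {φ : Plane → ℝ}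
    (hφ : Continuous φ) : Measurable fun p : Plane × Plane => collision γ β φ p.1 p.2 := by
  have := hβ.isFiniteMeasure
  have e : (fun p : Plane × Plane => collision γ β φ p.1 p.2) = fun p =>
      ‖p.1 - p.2‖ ^ γ * ∫ θ, (φ (postVel p.1 p.2 θ) - φ p.1) ∂β :=
    funext fun p => collision_eq hβ φ p.1 p.2
  rw [e]
  have h1 : Measurable fun p : Plane × Plane => ‖p.1 - p.2‖ ^ γ := by
    have : Continuous fun p : Plane × Plane => ‖p.1 - p.2‖ := by fun_prop
    exact this.measurable.pow_const γ
  have h2 : Continuous fun q : (Plane × Plane) × ℝ =>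
      φ (postVel q.1.1 q.1.2 q.2) - φ q.1.1 := by
    have h3 : Continuous fun q : (Plane × Plane) × ℝ => (q.1.1, (q.1.2, q.2)) := by fun_prop
    have h4 : Continuous fun q : (Plane × Plane) × ℝ => postVel q.1.1 q.1.2 q.2 :=
      (continuous_postVel.comp h3).congr fun _ => rfl
    exact (hφ.comp h4).sub (hφ.comp (by fun_prop))
  exact h1.mul (StronglyMeasurable.integral_prod_right h2.stronglyMeasurable).measurable

lemma abs_collision_le {γ : ℝ} {β : Measure ℝ} (hβ : IsCrossSection β) {φ : Plane → ℝ}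
    {K : ℝ≥0} (hφ : LipschitzWith K φ) (v w : Plane) :
    |collision γ β φ v w| ≤ K * β.real univ * ‖v - w‖ ^ (γ + 1) := by
  have := hβ.isFiniteMeasure
  rw [collision_eq hβ, abs_mul, abs_of_nonneg (Real.rpow_nonneg (norm_nonneg _) _)]
  have h1 : |∫ θ, (φ (postVel v w θ) - φ v) ∂β| ≤ K * ‖v - w‖ * β.real univ := by
    refine norm_integral_le_of_norm_le_const (μ := β) (f := fun θ => φ (postVel v w θ) - φ v)
      (Eventually.of_forall fun θ => ?_)
    have := hφ.dist_le_mul (postVel v w θ) v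
    rw [dist_eq_norm, dist_eq_norm] at this
    exact this.trans (mul_le_mul_of_nonneg_left (norm_postVel_sub_le v w θ) K.2)
  calc ‖v - w‖ ^ γ * |∫ θ, (φ (postVel v w θ) - φ v) ∂β|
      ≤ ‖v - w‖ ^ γ * (K * ‖v - w‖ * β.real univ) := by gcongr
    _ = K * β.real univ * (‖v - w‖ ^ γ * ‖v - w‖) := by ring
    _ ≤ _ := by
      gcongr
      exact rpow_mul_self_le (norm_nonneg _)

lemma integrable_collision_prod {r : ℝ} (hr : 0 < r) {γ : ℝ} (hγ : γ ∈ Ioo (-2 : ℝ) (-1))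
    {β : Measure ℝ} (hβ : IsCrossSection β) {μ : Measure Plane} [IsFiniteMeasure μ]
    {φ : Plane → ℝ} {K : ℝ≥0} (hφ : LipschitzWith K φ) :
    Integrable (fun p : Plane × Plane => collision γ β φ p.1 p.2)
      (μ.prod (uniformCircle r)) := by
  obtain ⟨C, hC0, hC⟩ := exists_potential_bound hr (p := γ + 1) (by linarith [hγ.1])
    (by linarith [hγ.2])
  have hm : Measurable fun p : Plane × Plane => ‖p.1 - p.2‖ ^ (γ + 1) := by
    have : Continuous fun p : Plane × Plane => ‖p.1 - p.2‖ := by fun_prop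
    exact this.measurable.pow_const _
  have hi : Integrable (fun p : Plane × Plane => ‖p.1 - p.2‖ ^ (γ + 1))
      (μ.prod (uniformCircle r)) := by
    rw [integrable_prod_iff hm.aestronglyMeasurable]
    refine ⟨Eventually.of_forall fun v => (hC v).1, ?_⟩
    refine Integrable.of_bound hm.aestronglyMeasurable.norm.integral_prod_right' C
      (Eventually.of_forall fun v => ?_)
    simp only [Real.norm_of_nonneg (Real.rpow_nonneg (norm_nonneg _) _)]
    rw [Real.norm_of_nonneg (integral_nonneg fun w => Real.rpow_nonneg (norm_nonneg _) _)]
    exact (hC v).2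
  exact (hi.const_mul (K * β.real univ)).mono'
    (measurable_collision hβ hφ.continuous).aestronglyMeasurable
    (Eventually.of_forall fun p => abs_collision_le hβ hφ p.1 p.2)

/-- The generator at a point of a stable ball only depends on the values of the function on this
ball. -/
lemma jumpGen_congr {r : ℝ} (hr : 0 ≤ r) {β : Measure ℝ} [IsFiniteMeasure β] {R : ℝ}
    (hR : StableBall r β R) (ρ : ℝ → ℝ) {φ ψ : Plane → ℝ} (h : ∀ v, ‖v‖ ≤ R → φ v = ψ v)
    {v : Plane} (hv : ‖v‖ ≤ R) : jumpGen r β ρ φ v = jumpGen r β ρ ψ v := by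
  have a1 : ∀ᵐ q ∂((uniformCircle r).prod β), ‖q.1‖ = r :=
    Measure.quasiMeasurePreserving_fst.ae (ae_norm_uniformCircle hr)
  have a2 : ∀ᵐ q ∂((uniformCircle r).prod β), ∀ v w : Plane, ‖v‖ ≤ R → ‖w‖ = r →
      ‖postVel v w q.2‖ ≤ R := Measure.quasiMeasurePreserving_snd.ae hR
  refine integral_congr_ae ?_
  filter_upwards [a1, a2] with q h1 h2
  rw [h v hv, h _ (h2 v q.1 hv h1)]

lemma exists_radial_solution {r : ℝ} (hr : 0 < r) {γ : ℝ} (hγ : γ ∈ Ioo (-2 : ℝ) (-1))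
    {β : Measure ℝ} (hβ : IsCrossSection β) (hβ₀ : VanishesNearZero β) :
    ∃ f : ℝ → Measure Plane, IsSolution (uniformCircle r) γ β f ∧ ∀ t, RotInvariant (f t) := by
  have := hβ.isFiniteMeasure
  obtain ⟨R, hrR, hR⟩ := exists_stableBall hr hβ hβ₀
  obtain ⟨f, hf, hsol⟩ := exists_radial_evolution hr hγ hβ.real_univ_pos hrR hR
  have hprob : ∀ t, IsProbabilityMeasure (f t) := fun t => (hf t).1
  have hgen : ∀ φ : Plane → ℝ, ∀ K, LipschitzWith K φ → ∀ v,
      ∫ w, collision γ β φ v w ∂(uniformCircle r) = jumpGen r β (fun x => x ^ γ) φ v :=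
    fun φ K hφ v => by
      obtain ⟨A, -, hi, -⟩ := exists_jumpGen_bound hr hγ (β := β) hφ
      exact integral_collision_eq_jumpGen hβ (hi v)
  -- a Lipschitz function agrees on the stable ball with a bounded Lipschitz function
  have hclamp : ∀ φ : Plane → ℝ, ∀ K, LipschitzWith K φ → ∃ ψ : Plane → ℝ, ∃ M,
      LipschitzWith K ψ ∧ (∀ v, |ψ v| ≤ M) ∧ ∀ v, ‖v‖ ≤ R → φ v = ψ v := fun φ K hφ => by
    have hR0 : 0 ≤ R := hr.le.trans hrR
    set M := |φ 0| + K * R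
    have hM0 : 0 ≤ M := by positivity
    refine ⟨fun v => max (min (φ v) M) (-M), M, (hφ.min_const M).max_const (-M), fun v => ?_,
      fun v hv => ?_⟩
    · rw [abs_le]
      exact ⟨le_max_right _ _, max_le (min_le_right _ _) (by linarith)⟩
    · have h1 : |φ v - φ 0| ≤ K * ‖v‖ := by
        simpa [Real.dist_eq, dist_eq_norm] using hφ.dist_le_mul v 0
      have h2 : |φ v| ≤ M := by
        have := abs_add_le (φ v - φ 0) (φ 0)
        rw [sub_add_cancel] at this
        have h3 : (K : ℝ) * ‖v‖ ≤ K * R := by gcongr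
        simp only [M]; linarith
      obtain ⟨h3, h4⟩ := abs_le.1 h2
      simp only [min_eq_left h4, max_eq_left h3]
  have hcongr : ∀ φ ψ : Plane → ℝ, (∀ v, ‖v‖ ≤ R → φ v = ψ v) → ∀ t, φ =ᵐ[f t] ψ :=
    fun φ ψ h t => (hf t).2.2.mono fun v hv => h v hv
  have hmain : ∀ φ : Plane → ℝ, (∃ K, LipschitzWith K φ) → ∀ t, 0 ≤ t →
      IntervalIntegrable (fun s => ∫ v, ∫ w, collision γ β φ v w ∂(uniformCircle r) ∂(f s))
        volume 0 t ∧ ∫ v, φ v ∂(f t) = ∫ v, φ v ∂(uniformCircle r) +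
      ∫ s in (0 : ℝ)..t, ∫ v, ∫ w, collision γ β φ v w ∂(uniformCircle r) ∂(f s) := by
    rintro φ ⟨K, hφ⟩ t ht
    obtain ⟨ψ, M, hψ, hM, heq⟩ := hclamp φ K hφ
    have h1 := hsol ψ ⟨K, hψ⟩ M hM t ht
    have e1 : ∀ s, ∫ v, ∫ w, collision γ β φ v w ∂(uniformCircle r) ∂(f s) =
        ∫ v, jumpGen r β (fun x => x ^ γ) ψ v ∂(f s) := fun s => by
      simp only [hgen φ K hφ]
      exact integral_congr_ae (hcongr _ _ (fun v hv => jumpGen_congr hr.le hR _ heq hv) s)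
    have e2 : ∫ v, φ v ∂(uniformCircle r) = ∫ v, ψ v ∂(uniformCircle r) :=
      integral_congr_ae ((ae_norm_uniformCircle hr.le).mono fun v hv => heq v (hv.trans_le hrR))
    simp only [e1]
    rw [e2, integral_congr_ae (hcongr φ ψ heq t)]
    exact h1
  refine ⟨f, ⟨fun t _ => (hf t).1, ?_, ?_, fun φ hφ t ht => (hmain φ hφ t ht).1,
    fun φ hφ t ht => (hmain φ hφ t ht).2⟩, fun t => (hf t).2.1⟩
  · rintro φ ⟨K, hφ⟩ t -
    obtain ⟨ψ, M, hψ, hM, heq⟩ := hclamp φ K hφ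
    exact (Integrable.of_bound hψ.continuous.aestronglyMeasurable M
      (Eventually.of_forall hM)).congr (hcongr φ ψ heq t).symm
  · rintro φ ⟨K, hφ⟩ s -
    exact integrable_collision_prod hr hγ hβ hφ

/-! ### Compact sets off the circle which collisions do not charge -/

/-- The tent function of height `1` around `K`, of slope `c`. -/
noncomputable def tent (K : Set Plane) (c : ℝ) (x : Plane) : ℝ := max (1 - c * Metric.infDist x K) 0

lemma lipschitzWith_tent (K : Set Plane) {c : ℝ} (hc : 0 ≤ c) :
    LipschitzWith (Real.toNNReal c) (tent K c) := by
  refine LipschitzWith.max_const (LipschitzWith.of_dist_le_mul fun x y => ?_) 0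
  rw [Real.coe_toNNReal _ hc, Real.dist_eq,
    show 1 - c * Metric.infDist x K - (1 - c * Metric.infDist y K) =
      -(c * (Metric.infDist x K - Metric.infDist y K)) by ring, abs_neg, abs_mul, abs_of_nonneg hc]
  refine mul_le_mul_of_nonneg_left ?_ hc
  have := (Metric.lipschitz_infDist_pt K).dist_le_mul x y
  rwa [Real.dist_eq, NNReal.coe_one, one_mul] at this

lemma tent_nonneg (K : Set Plane) (c : ℝ) (x : Plane) : 0 ≤ tent K c x := le_max_right _ _

lemma tent_le_one (K : Set Plane) {c : ℝ} (hc : 0 ≤ c) (x : Plane) : tent K c x ≤ 1 :=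
  max_le (by have := mul_nonneg hc (Metric.infDist_nonneg (x := x) (s := K)); linarith) zero_le_one

lemma tent_eq_one {K : Set Plane} {c : ℝ} {x : Plane} (hx : x ∈ K) : tent K c x = 1 := by
  simp [tent, Metric.infDist_zero_of_mem hx]

lemma tent_eq_zero {K : Set Plane} {c : ℝ} {x : Plane} (hx : 1 ≤ c * Metric.infDist x K) :
    tent K c x = 0 := max_eq_right (by linarith)

lemma tendsto_tent {K : Set Plane} (hK : IsClosed K) (hne : K.Nonempty) (c : ℝ) {x : Plane}
    (hx : x ∉ K) : Tendsto (fun n : ℕ => tent K (n + c) x) atTop (𝓝 0) := by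
  have hpos : 0 < Metric.infDist x K := (hK.notMem_iff_infDist_pos hne).1 hx
  have h1 : Tendsto (fun n : ℕ => ((n : ℝ) + c) * Metric.infDist x K) atTop atTop :=
    (tendsto_atTop_add_const_right _ c tendsto_natCast_atTop_atTop).atTop_mul_const hpos
  refine tendsto_const_nhds.congr' ?_
  filter_upwards [h1.eventually_ge_atTop 1] with n hn
  exact (tent_eq_zero hn).symm

/-- If the collisions of the particles almost surely do not lead into a compact set `K` which does
not meet the circle, then `K` is never charged: particles sufficiently close to `K` have a bounded
collision rate, so the weak equation passes to the limit along tent functions decreasing to the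
indicator function of `K`; the gain vanishes in the limit, and the loss is nonpositive. -/
lemma IsSolution.measure_eq_zero_of_isCompact {r : ℝ} (hr : 0 < r) {γ : ℝ}
    (hγ : γ ∈ Ioo (-2 : ℝ) (-1)) {β : Measure ℝ}
    (hβ : IsCrossSection β) {f : ℝ → Measure Plane} (hf : IsSolution (uniformCircle r) γ β f)
    {K : Set Plane} (hK : IsCompact K) (hKr : ∀ v ∈ K, ‖v‖ ≠ r)
    (hnull : ∀ s, 0 ≤ s → ∀ᵐ p ∂((f s).prod (uniformCircle r)), ∀ᵐ θ ∂β,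
      postVel p.1 p.2 θ ∉ K) {t : ℝ} (ht : 0 ≤ t) : f t K = 0 := by
  have := hβ.isFiniteMeasure
  rcases K.eq_empty_or_nonempty with rfl | hne
  · exact measure_empty
  -- `K` is at distance at least `m` from the circle
  obtain ⟨x₀, hx₀, hmin⟩ := hK.exists_isMinOn hne
    (f := fun v => |‖v‖ - r|) (by fun_prop)
  set m := |‖x₀‖ - r| with hm
  have hm0 : 0 < m := abs_pos.2 (sub_ne_zero.2 (hKr x₀ hx₀))
  have hmK : ∀ v ∈ K, m ≤ |‖v‖ - r| := fun v hv => hmin hv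
  set φ : ℕ → Plane → ℝ := fun n => tent K (n + 2 / m) with hφ
  have hc0 : ∀ n : ℕ, 0 ≤ (n : ℝ) + 2 / m := fun n => by positivity
  have hφL : ∀ n, ∃ L, LipschitzWith L (φ n) := fun n => ⟨_, lipschitzWith_tent K (hc0 n)⟩
  have hφc : ∀ n, Continuous (φ n) := fun n => (lipschitzWith_tent K (hc0 n)).continuous
  have hφ0 : ∀ n x, 0 ≤ φ n x := fun n x => tent_nonneg _ _ _
  have hφ1 : ∀ n x, φ n x ≤ 1 := fun n x => tent_le_one _ (hc0 n) _
  have hsupp : ∀ n x, |‖x‖ - r| < m / 2 → φ n x = 0 := fun n x hx => by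
    refine tent_eq_zero ?_
    obtain ⟨y, hy, hxy⟩ := hK.exists_infDist_eq_dist hne x
    rw [hxy]
    have h1 : m / 2 ≤ dist x y := by
      have h2 := hmK y hy
      have h3 := abs_norm_sub_norm_le x y
      rw [← dist_eq_norm, abs_sub_comm] at h3
      have h4 := abs_add_le (‖y‖ - ‖x‖) (‖x‖ - r)
      rw [sub_add_sub_cancel] at h4
      linarith
    calc (1 : ℝ) = 2 / m * (m / 2) := by field_simp
      _ ≤ (n + 2 / m) * dist x y := by
        gcongr
        linarith [Nat.cast_nonneg (α := ℝ) n]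
  set B := (m / 2) ^ γ * β.real univ with hB
  have hB0 : 0 ≤ B := by positivity
  have hcoll : ∀ n v w, ‖w‖ = r → |collision γ β (φ n) v w| ≤ B := by
    intro n v w hw
    rw [collision_eq hβ, abs_mul, abs_of_nonneg (Real.rpow_nonneg (norm_nonneg _) _)]
    rcases le_or_gt (m / 2) ‖v - w‖ with h | h
    · refine mul_le_mul ?_ ?_ (abs_nonneg _) (by positivity)
      · exact Real.rpow_le_rpow_of_nonpos (by positivity) h (by linarith [hγ.2])
      · have := norm_integral_le_of_norm_le_const (μ := β)
          (f := fun θ => φ n (postVel v w θ) - φ n v) (C := 1) (Eventually.of_forall fun θ => by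
            rw [Real.norm_eq_abs, abs_le]
            constructor <;>
              linarith [hφ0 n v, hφ1 n v, hφ0 n (postVel v w θ), hφ1 n (postVel v w θ)])
        simpa using this
    · have hz : ∀ u : Plane, ‖u - w‖ ≤ ‖v - w‖ → φ n u = 0 := fun u hu => by
        refine hsupp n u ?_
        rw [← hw]
        exact (abs_norm_sub_norm_le u w).trans_lt (hu.trans_lt h)
      simp only [hz _ (norm_postVel_sub_right_le v w _), hz v le_rfl]
      simpa using hB0
  set H : ℕ → ℝ → ℝ := fun n s => ∫ v, ∫ w, collision γ β (φ n) v w ∂(uniformCircle r) ∂(f s)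
    with hH
  have hw : ∀ s, ∀ᵐ p ∂((f s).prod (uniformCircle r)), ‖p.2‖ = r := fun s =>
    Measure.quasiMeasurePreserving_snd.ae (ae_norm_uniformCircle hr.le)
  have hHeq : ∀ n s, 0 ≤ s → H n s =
      ∫ p : Plane × Plane, collision γ β (φ n) p.1 p.2 ∂((f s).prod (uniformCircle r)) :=
    fun n s hs => by
      have := hf.isProb s hs
      exact (integral_prod _ (hf.integrable_collision _ (hφL n) s hs)).symm
  set P : ℕ → ℝ → ℝ := fun n s =>
    ∫ p : Plane × Plane, max (collision γ β (φ n) p.1 p.2) 0 ∂((f s).prod (uniformCircle r))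
    with hP
  have hHP : ∀ n s, 0 ≤ s → max (H n s) 0 ≤ P n s := fun n s hs => by
    refine max_le ?_ (integral_nonneg fun p => le_max_right _ _)
    rw [hHeq n s hs]
    have hi := hf.integrable_collision _ (hφL n) s hs
    exact integral_mono hi hi.pos_part fun p => le_max_left _ _
  have hHB : ∀ n s, 0 ≤ s → |max (H n s) 0| ≤ B := fun n s hs => by
    have := hf.isProb s hs
    have h1 : |H n s| ≤ B := by
      rw [hHeq n s hs]
      have h2 : ∀ᵐ p ∂((f s).prod (uniformCircle r)), ‖collision γ β (φ n) p.1 p.2‖ ≤ B :=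
        (hw s).mono fun p hp => hcoll n p.1 p.2 hp
      simpa using norm_integral_le_of_norm_le_const h2
    rw [abs_of_nonneg (le_max_right _ _)]
    exact max_le ((le_abs_self _).trans h1) hB0
  have hPlim : ∀ s, 0 ≤ s → Tendsto (fun n => P n s) atTop (𝓝 0) := fun s hs => by
    have := hf.isProb s hs
    rw [show (0 : ℝ) = ∫ p : Plane × Plane, (0 : ℝ) ∂((f s).prod (uniformCircle r)) by simp]
    refine tendsto_integral_of_dominated_convergence (fun _ => B)
      (fun n => (hf.integrable_collision _ (hφL n) s hs).pos_part.aestronglyMeasurable)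
      (integrable_const _) (fun n => ?_) ?_
    · filter_upwards [hw s] with p hp
      rw [Real.norm_of_nonneg (le_max_right _ _)]
      exact max_le ((le_abs_self _).trans (hcoll n p.1 p.2 hp)) hB0
    · filter_upwards [hnull s hs] with p hp
      have hpc : Continuous fun θ => postVel p.1 p.2 θ := by
        have : Continuous fun θ : ℝ => (p.1, (p.2, θ)) := by fun_prop
        exact (continuous_postVel.comp this).congr fun _ => rfl
      have hg : Tendsto (fun n => ‖p.1 - p.2‖ ^ γ * ∫ θ, φ n (postVel p.1 p.2 θ) ∂β) atTop
          (𝓝 (‖p.1 - p.2‖ ^ γ * ∫ θ, (0 : ℝ) ∂β)) := by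
        refine (tendsto_integral_of_dominated_convergence (fun _ => 1)
          (fun n => ((hφc n).comp hpc).aestronglyMeasurable) (integrable_const _)
          (fun n => Eventually.of_forall fun θ => ?_) ?_).const_mul _
        · rw [Function.comp_apply, Real.norm_of_nonneg (hφ0 _ _)]; exact hφ1 _ _
        · filter_upwards [hp] with θ hθ
          exact tendsto_tent hK.isClosed hne _ hθ
      rw [integral_zero, mul_zero] at hg
      refine tendsto_of_tendsto_of_tendsto_of_le_of_le tendsto_const_nhds hg
        (fun n => le_max_right _ _) fun n => ?_
      have hint : Integrable (fun θ => φ n (postVel p.1 p.2 θ)) β :=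
        Integrable.of_bound ((hφc n).comp hpc).aestronglyMeasurable 1
          (Eventually.of_forall fun θ => by
            rw [Real.norm_of_nonneg (hφ0 _ _)]; exact hφ1 _ _)
      have hpow := Real.rpow_nonneg (norm_nonneg (p.1 - p.2)) γ
      refine max_le ?_ (mul_nonneg hpow (integral_nonneg fun θ => hφ0 _ _))
      rw [collision_eq hβ]
      refine mul_le_mul_of_nonneg_left ?_ hpow
      exact integral_mono (hint.sub (integrable_const _)) hint fun θ => by
        have := hφ0 n p.1
        simp only; linarith
  have hnonneg : ∀ s ∈ uIoc 0 t, 0 ≤ s := fun s hs => by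
    rw [uIoc_of_le ht] at hs; exact hs.1.le
  have hlim : Tendsto (fun n => ∫ s in (0 : ℝ)..t, max (H n s) 0) atTop (𝓝 0) := by
    suffices h : Tendsto (fun n => ∫ s in (0 : ℝ)..t, max (H n s) 0) atTop
        (𝓝 (∫ s in (0 : ℝ)..t, (0 : ℝ))) by simpa using h
    refine intervalIntegral.tendsto_integral_filter_of_dominated_convergence
      (μ := volume) (F := fun n s => max (H n s) 0) (fun _ => B)
      (Eventually.of_forall fun n => ?_) (Eventually.of_forall fun n => Eventually.of_forall
        fun s hs => hHB n s (hnonneg s hs)) intervalIntegrable_const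
      (Eventually.of_forall fun s hs => ?_)
    · exact ((hf.integrable_time _ (hφL n) t ht).def'.pos_part).aestronglyMeasurable
    · exact tendsto_of_tendsto_of_tendsto_of_le_of_le tendsto_const_nhds
        (hPlim s (hnonneg s hs)) (fun n => le_max_right _ _) fun n => hHP n s (hnonneg s hs)
  have hbound : ∀ n, (f t).real K ≤ ∫ s in (0 : ℝ)..t, max (H n s) 0 := fun n => by
    have := hf.isProb t ht
    have h1 : (f t).real K ≤ ∫ v, φ n v ∂(f t) := by
      rw [← integral_indicator_one hK.measurableSet]
      refine integral_mono ((integrable_const 1).indicator hK.measurableSet)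
        (hf.integrable _ (hφL n) t ht) fun v => ?_
      by_cases hv : v ∈ K
      · rw [indicator_of_mem hv, Pi.one_apply]; exact (tent_eq_one hv).ge
      · rw [indicator_of_notMem hv]; exact hφ0 n v
    have h2 : ∫ v, φ n v ∂(uniformCircle r) = 0 := by
      refine integral_eq_zero_of_ae ?_
      filter_upwards [ae_norm_uniformCircle hr.le] with v hv
      exact hsupp n v (by rw [hv, sub_self, abs_zero]; positivity)
    rw [hf.weak_eq _ (hφL n) t ht, h2, zero_add] at h1
    refine h1.trans (intervalIntegral.integral_mono_on ht (hf.integrable_time _ (hφL n) t ht) ?_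
      fun s hs => le_max_left _ _)
    have := (hf.integrable_time _ (hφL n) t ht)
    exact ⟨this.1.pos_part, this.2.pos_part⟩
  have h0 : (f t).real K ≤ 0 := ge_of_tendsto' hlim hbound
  have := hf.isProb t ht
  exact (measureReal_eq_zero_iff).1 (le_antisymm h0 measureReal_nonneg)

/-! ### Collisions of rotationally symmetric particles produce densities -/

lemma volume_plane_preimage {N : Set Plane} (hN : volume N = 0) :
    volume {p : ℝ × ℝ | (!₂[p.1, p.2] : Plane) ∈ N} = 0 := by
  have h1 := ((EuclideanSpace.volume_preserving_symm_measurableEquiv_toLp (Fin 2)).symm).comp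
    (volume_preserving_finTwoArrow ℝ).symm
  have h2 := h1.quasiMeasurePreserving.preimage_null hN
  exact h2

/-- Integration in polar coordinates: a Lebesgue-null set is null for the uniform distribution on
almost every circle. -/
lemma ae_ae_circle_notMem {N : Set Plane} (hN : volume N = 0) :
    ∀ᵐ ρ ∂(volume.restrict (Ioi (0 : ℝ))), ∀ᵐ a ∂(volume.restrict (Ioc (-Real.pi) Real.pi)),
      (!₂[ρ * Real.cos a, ρ * Real.sin a] : Plane) ∉ N := by
  set T := toMeasurable volume {p : ℝ × ℝ | (!₂[p.1, p.2] : Plane) ∈ N} with hT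
  have hTm : MeasurableSet T := measurableSet_toMeasurable _ _
  have hT0 : volume T = 0 := by rw [hT, measure_toMeasurable, volume_plane_preimage hN]
  have h1 := lintegral_comp_polarCoord_symm (T.indicator 1)
  rw [lintegral_indicator_one hTm, hT0, polarCoord_target] at h1
  have hm : Measurable fun p : ℝ × ℝ => ENNReal.ofReal p.1 •
      T.indicator (1 : ℝ × ℝ → ℝ≥0∞) (polarCoord.symm p) := by
    have hc : Continuous fun p : ℝ × ℝ => polarCoord.symm p := by
      have : (fun p : ℝ × ℝ => polarCoord.symm p) =
        fun p => (p.1 * Real.cos p.2, p.1 * Real.sin p.2) := rfl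
      rw [this]; fun_prop
    exact measurable_fst.ennreal_ofReal.mul ((measurable_one.indicator hTm).comp hc.measurable)
  rw [lintegral_eq_zero_iff hm, Measure.volume_eq_prod, ← Measure.prod_restrict] at h1
  have h2 := Measure.ae_ae_of_ae_prod h1
  rw [Measure.restrict_congr_set Ioo_ae_eq_Ioc] at h2
  filter_upwards [h2, ae_restrict_mem measurableSet_Ioi] with ρ hρ hρ0
  filter_upwards [hρ] with a ha hmem
  have h3 : polarCoord.symm (ρ, a) ∈ T := subset_toMeasurable _ _ hmem
  simp only [indicator_of_mem h3, Pi.one_apply, Pi.zero_apply, smul_eq_mul, mul_one,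
    ENNReal.ofReal_eq_zero] at ha
  exact absurd ha (not_le.2 hρ0)

/-- A rotationally symmetric measure is determined by the law of the modulus: it does not charge a
set which is null for the uniform distributions on almost all the relevant circles. -/
lemma RotInvariant.measure_eq_zero {ν : Measure Plane} [IsFiniteMeasure ν] (hν : RotInvariant ν)
    {N : Set Plane} (hN : MeasurableSet N)
    (h : ∀ᵐ v ∂ν, ∀ᵐ a ∂(volume.restrict (Ioc (-Real.pi) Real.pi)),
      (!₂[‖v‖ * Real.cos a, ‖v‖ * Real.sin a] : Plane) ∉ N) : ν N = 0 := by
  have h1 : ∀ᵐ v ∂ν, ∀ᵐ a ∂(volume.restrict (Ioc (-Real.pi) Real.pi)), rot a v ∉ N := by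
    filter_upwards [h] with v hv
    obtain ⟨η, hη⟩ := exists_eq_rot v
    have hz : ∀ M : Set Plane, MeasurableSet M → (uniformCircle ‖v‖ M = 0 ↔
        ∀ᵐ a ∂(volume.restrict (Ioc (-Real.pi) Real.pi)),
          (!₂[‖v‖ * Real.cos a, ‖v‖ * Real.sin a] : Plane) ∉ M) := fun M hM => by
      have hp : ENNReal.ofReal (1 / (2 * Real.pi)) ≠ 0 := by
        have := Real.pi_pos
        rw [Ne, ENNReal.ofReal_eq_zero, not_le]; positivity
      rw [uniformCircle, Measure.smul_apply, smul_eq_mul, mul_eq_zero, or_iff_right hp,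
        Measure.map_apply (measurable_circle_param _) hM, ae_iff]
      simp only [not_not]
      rfl
    have h2 := (hz N hN).2 hv
    rw [← rotInvariant_uniformCircle ‖v‖ η, Measure.map_apply (measurable_rot η) hN,
      hz _ (measurable_rot η hN)] at h2
    filter_upwards [h2] with a ha hmem
    refine ha ?_
    rw [mem_preimage]
    convert hmem using 1
    conv_rhs => rw [hη]
    rw [rot_rot, rot_circle_param]
    apply plane_ext <;> simp <;> ring
  have hmeas : MeasurableSet {x : Plane × ℝ | rot x.2 x.1 ∉ N} := by
    have : Continuous fun x : Plane × ℝ => rot x.2 x.1 :=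
      (continuous_rot_uncurry.comp continuous_swap).congr fun _ => rfl
    exact (this.measurable hN).compl
  rw [Measure.ae_ae_comm (p := fun v a => rot a v ∉ N) hmeas] at h1
  have hne : NeZero (volume.restrict (Ioc (-Real.pi) Real.pi)) := by
    refine ⟨fun h0 => ?_⟩
    have := congrArg (fun m => m univ) h0
    simp only [Measure.restrict_apply_univ, Real.volume_Ioc, Measure.coe_zero, Pi.zero_apply,
      ENNReal.ofReal_eq_zero] at this
    linarith [Real.pi_pos]
  obtain ⟨a, ha⟩ := h1.exists
  rw [← hν a, Measure.map_apply (measurable_rot a) hN]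
  exact measure_eq_zero_iff_ae_notMem.2 ha

/-- The law of `A + B sin a`, `a` uniform, has a density. -/
lemma ae_affine_sin_notMem {A B : ℝ} (hB : B ≠ 0) {N : Set ℝ} (hN : volume N = 0) :
    ∀ᵐ a ∂(volume.restrict (Ioc (-Real.pi) Real.pi)), A + B * Real.sin a ∉ N := by
  set T : Set ℝ := {x | x ∈ Ioo (-1 : ℝ) 1 ∧ A + B * x ∈ N} with hT
  have hT0 : volume T = 0 := by
    have h1 : volume ((fun y : ℝ => (y - A) / B) '' N) = 0 :=
      addHaar_image_eq_zero_of_differentiableOn_of_addHaar_eq_zero volume (by fun_prop) hN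
    have h2 : T ⊆ (fun y : ℝ => (y - A) / B) '' N := fun x hx =>
      ⟨A + B * x, hx.2, by simp only; field_simp; ring⟩
    exact measure_mono_null h2 h1
  have hd : ∀ x ∈ T, DifferentiableAt ℝ Real.arcsin x := fun x hx =>
    Real.differentiableAt_arcsin.2 ⟨hx.1.1.ne', hx.1.2.ne⟩
  have himg : ∀ c e : ℝ, volume ((fun x => c + e * Real.arcsin x) '' T) = 0 := fun c e =>
    addHaar_image_eq_zero_of_differentiableOn_of_addHaar_eq_zero volume
      (fun x hx => (((hd x hx).const_mul e).const_add c).differentiableWithinAt) hT0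
  have hbad : ∀ᵐ a : ℝ, a ∉ (fun x => 0 + 1 * Real.arcsin x) '' T ∧
      a ∉ (fun x => Real.pi + (-1) * Real.arcsin x) '' T ∧
      a ∉ (fun x => -Real.pi + (-1) * Real.arcsin x) '' T ∧ a ≠ Real.pi / 2 ∧
      a ≠ -(Real.pi / 2) := by
    filter_upwards [measure_eq_zero_iff_ae_notMem.1 (himg 0 1),
      measure_eq_zero_iff_ae_notMem.1 (himg Real.pi (-1)),
      measure_eq_zero_iff_ae_notMem.1 (himg (-Real.pi) (-1)), Measure.ae_ne volume (Real.pi / 2),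
      Measure.ae_ne volume (-(Real.pi / 2))] with a h1 h2 h3 h4 h5
    exact ⟨h1, h2, h3, h4, h5⟩
  filter_upwards [ae_restrict_of_ae hbad, ae_restrict_mem measurableSet_Ioc] with a ha hI hmem
  obtain ⟨h1, h2, h3, h4, h5⟩ := ha
  have hsin : ∀ b : ℝ, -(Real.pi / 2) < b → b < Real.pi / 2 →
      Real.sin b ∈ Ioo (-1 : ℝ) 1 := fun b hb hb' => by
    have hc := Real.cos_pos_of_mem_Ioo ⟨hb, hb'⟩
    have := Real.sin_sq_add_cos_sq b
    exact abs_lt.1 (by rw [← sq_lt_one_iff_abs_lt_one]; nlinarith)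
  rcases lt_or_gt_of_ne h5 with g1 | g1
  · have e : Real.sin (-Real.pi - a) = Real.sin a := by
      rw [show -Real.pi - a = -(a + Real.pi) by ring, Real.sin_neg, Real.sin_add_pi, neg_neg]
    refine h3 ⟨Real.sin a, ⟨?_, hmem⟩, ?_⟩
    · rw [← e]; exact hsin _ (by linarith) (by linarith [hI.1])
    · simp only; rw [← e, Real.arcsin_sin (by linarith) (by linarith [hI.1])]; ring
  rcases lt_or_gt_of_ne h4 with g2 | g2
  · refine h1 ⟨Real.sin a, ⟨hsin a g1 g2, hmem⟩, ?_⟩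
    simp only; rw [Real.arcsin_sin g1.le g2.le]; ring
  · have e : Real.sin (Real.pi - a) = Real.sin a := Real.sin_pi_sub a
    refine h2 ⟨Real.sin a, ⟨?_, hmem⟩, ?_⟩
    · rw [← e]; exact hsin _ (by linarith [hI.2]) (by linarith)
    · simp only; rw [← e, Real.arcsin_sin (by linarith [hI.2]) (by linarith)]; ring

/-- The speed after the collision of a particle of velocity `v ≠ 0` with a uniform partner has a
density. -/
lemma ae_norm_postVel_notMem {r : ℝ} (hr : 0 < r) {θ : ℝ} (hθ : Real.sin θ ≠ 0) {v : Plane}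
    (hv : v ≠ 0) {N : Set ℝ} (hN : volume N = 0) :
    ∀ᵐ w ∂(uniformCircle r), ‖postVel v w θ‖ ∉ N := by
  set T := toMeasurable volume N with hT
  have hTm : MeasurableSet T := measurableSet_toMeasurable _ _
  have hT0 : volume T = 0 := by rw [hT, measure_toMeasurable, hN]
  have hT2 : volume ((fun x : ℝ => x ^ 2) '' T) = 0 :=
    addHaar_image_eq_zero_of_differentiableOn_of_addHaar_eq_zero volume (by fun_prop) hT0
  obtain ⟨η, hη⟩ := exists_eq_rot v
  have hpost : ∀ u, Measurable fun w : Plane => ‖postVel u w θ‖ := fun u => by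
    have h1 : Continuous fun w : Plane => (u, (w, θ)) := by fun_prop
    have h2 : Continuous fun w : Plane => postVel u w θ :=
      (continuous_postVel.comp h1).congr fun _ => rfl
    exact h2.norm.measurable
  have h1 : ∀ᵐ w ∂(uniformCircle r), ‖postVel !₂[‖v‖, 0] w θ‖ ∉ T := by
    refine ae_uniformCircle r (hpost _ hTm).compl ?_
    filter_upwards [ae_affine_sin_notMem (A := ‖v‖ ^ 2 * (1 + Real.cos θ) / 2 +
      r ^ 2 * (1 - Real.cos θ) / 2) (B := ‖v‖ * r * Real.sin θ)
      (mul_ne_zero (mul_ne_zero (norm_ne_zero_iff.2 hv) hr.ne') hθ) hT2] with a ha hmem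
    refine ha ⟨_, hmem, ?_⟩
    exact norm_sq_postVel_axis ‖v‖ r a θ
  have h2 : ∀ᵐ w ∂(uniformCircle r), ‖postVel v w θ‖ ∉ T := by
    rw [← rotInvariant_uniformCircle r η, ae_map_iff (p := fun w => ‖postVel v w θ‖ ∉ T)
      (measurable_rot η).aemeasurable (hpost v hTm).compl]
    filter_upwards [h1] with w hw
    rwa [hη, postVel_rot, norm_rot]
  filter_upwards [h2] with w hw hmem using hw (subset_toMeasurable _ _ hmem)

lemma measurable_postVel_pair (θ : ℝ) : Measurable fun p : Plane × Plane => postVel p.1 p.2 θ := by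
  have h1 : Continuous fun p : Plane × Plane => (p.1, (p.2, θ)) := by fun_prop
  exact ((continuous_postVel.comp h1).congr fun _ => rfl :
    Continuous fun p : Plane × Plane => postVel p.1 p.2 θ).measurable

/-- A collision of a rotationally symmetric random velocity, which does not charge the origin, with
a uniform partner produces a velocity having a density. -/
lemma ae_postVel_notMem_of_volume_eq_zero {r : ℝ} (hr : 0 < r) {θ : ℝ} (hθ : Real.sin θ ≠ 0)
    {μ : Measure Plane} [IsFiniteMeasure μ] (hμ : RotInvariant μ) (h0 : μ {0} = 0)
    {N : Set Plane} (hNm : MeasurableSet N) (hN : volume N = 0) :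
    ∀ᵐ p ∂(μ.prod (uniformCircle r)), postVel p.1 p.2 θ ∉ N := by
  have hpost := measurable_postVel_pair θ
  set ν := (μ.prod (uniformCircle r)).map fun p => postVel p.1 p.2 θ with hν
  have hνf : IsFiniteMeasure ν := Measure.isFiniteMeasure_map _ _
  have hrot : RotInvariant ν := fun η => by
    have hp : MeasurePreserving (Prod.map (rot η) (rot η)) (μ.prod (uniformCircle r))
        (μ.prod (uniformCircle r)) :=
      MeasurePreserving.prod ⟨measurable_rot η, hμ η⟩
        ⟨measurable_rot η, rotInvariant_uniformCircle r η⟩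
    rw [hν, Measure.map_map (measurable_rot η) hpost]
    conv_rhs => rw [← hp.map_eq, Measure.map_map hpost hp.measurable]
    congr 1
    funext p
    exact (postVel_rot η p.1 p.2 θ).symm
  -- the exceptional radii
  obtain ⟨Z, hZ0, hZ⟩ : ∃ Z : Set ℝ, volume Z = 0 ∧ ∀ ρ, 0 ≤ ρ → ρ ∉ Z →
      ∀ᵐ a ∂(volume.restrict (Ioc (-Real.pi) Real.pi)),
        (!₂[ρ * Real.cos a, ρ * Real.sin a] : Plane) ∉ N := by
    have h1 := ae_ae_circle_notMem hN
    rw [ae_restrict_iff' measurableSet_Ioi, ae_iff] at h1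
    refine ⟨_ ∪ {0}, measure_union_null h1 (measure_singleton 0), fun ρ hρ hρZ => ?_⟩
    simp only [mem_union, mem_ofPred_eq, mem_singleton_iff, not_or, not_not] at hρZ
    exact hρZ.1 (lt_of_le_of_ne hρ (Ne.symm hρZ.2))
  set Z' := toMeasurable volume Z with hZ'
  have hZm : MeasurableSet Z' := measurableSet_toMeasurable _ _
  have hZ0' : volume Z' = 0 := by rw [hZ', measure_toMeasurable, hZ0]
  have h2 : ∀ᵐ x ∂ν, ‖x‖ ∉ Z' := by
    rw [hν, ae_map_iff (p := fun x => ‖x‖ ∉ Z') hpost.aemeasurable (measurable_norm hZm).compl]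
    rw [Measure.ae_prod_iff_ae_ae (p := fun p => ‖postVel p.1 p.2 θ‖ ∉ Z')
      (hpost.norm hZm).compl]
    have h3 : ∀ᵐ v ∂μ, v ≠ 0 := by rw [ae_iff]; simpa using h0
    filter_upwards [h3] with v hv using ae_norm_postVel_notMem hr hθ hv hZ0'
  have h4 : ν N = 0 := hrot.measure_eq_zero hNm (by
    filter_upwards [h2] with x hx
    exact hZ _ (norm_nonneg x) fun h => hx (subset_toMeasurable _ _ h))
  rw [hν, Measure.map_apply hpost hNm] at h4
  exact measure_eq_zero_iff_ae_notMem.1 h4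

/-- A given velocity is reached from `v` with at most one partner. -/
lemma ae_postVel_ne {r : ℝ} (hr : 0 < r) {θ : ℝ} (hθ : Real.cos θ ≠ 1) (v x : Plane) :
    ∀ᵐ w ∂(uniformCircle r), postVel v w θ ≠ x := by
  by_cases h : ∃ w₀, postVel v w₀ θ = x
  · obtain ⟨w₀, hw₀⟩ := h
    filter_upwards [ae_ne_uniformCircle hr w₀] with w hw hwx
    have h1 := norm_sq_postVel_sub_postVel_right v w w₀ θ
    rw [hwx, hw₀, sub_self, norm_zero, zero_pow two_ne_zero, eq_comm, mul_eq_zero] at h1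
    rcases h1 with h1 | h1
    · exact hθ (by linarith)
    · exact hw (sub_eq_zero.1 (norm_eq_zero.1 (pow_eq_zero_iff two_ne_zero |>.1 h1)))
  · exact Eventually.of_forall fun w hw => h ⟨w, hw⟩

/-- Off the circle, a rotationally symmetric solution has a density at every time. -/
lemma IsSolution.measure_eq_zero_of_volume_eq_zero {r : ℝ} (hr : 0 < r) {γ : ℝ}
    (hγ : γ ∈ Ioo (-2 : ℝ) (-1)) {β : Measure ℝ} (hβ : IsCrossSection β)
    {f : ℝ → Measure Plane} (hf : IsSolution (uniformCircle r) γ β f)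
    (hrot : ∀ t, RotInvariant (f t)) {N : Set Plane} (hNm : MeasurableSet N)
    (hN : volume N = 0) (hNr : ∀ v ∈ N, ‖v‖ ≠ r) {t : ℝ} (ht : 0 ≤ t) : f t N = 0 := by
  have := hβ.isFiniteMeasure
  have hθ : ∀ᵐ θ ∂β, θ ∈ Icc (-(Real.pi / 2)) (Real.pi / 2) \ {0} := hβ.carrier
  have hπ := Real.pi_pos
  have hsin : ∀ θ ∈ Icc (-(Real.pi / 2)) (Real.pi / 2) \ {0}, Real.sin θ ≠ 0 := fun θ hθ h => by
    rw [Real.sin_eq_zero_iff_of_lt_of_lt (by linarith [hθ.1.1]) (by linarith [hθ.1.2])] at h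
    exact hθ.2 h
  have hcos : ∀ θ ∈ Icc (-(Real.pi / 2)) (Real.pi / 2) \ {0}, Real.cos θ ≠ 1 := fun θ hθ h => by
    have h1 := Real.sin_sq_add_cos_sq θ
    rw [h] at h1
    exact hsin θ hθ (pow_eq_zero_iff two_ne_zero |>.1 (by linarith))
  have hcomm : ∀ K : Set Plane, MeasurableSet K → ∀ s, 0 ≤ s →
      (∀ᵐ θ ∂β, ∀ᵐ p ∂((f s).prod (uniformCircle r)), postVel p.1 p.2 θ ∉ K) →
      ∀ᵐ p ∂((f s).prod (uniformCircle r)), ∀ᵐ θ ∂β, postVel p.1 p.2 θ ∉ K :=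
    fun K hK s hs h => by
      have := hf.isProb s hs
      have hm : Continuous fun x : (Plane × Plane) × ℝ => postVel x.1.1 x.1.2 x.2 := by
        have h1 : Continuous fun x : (Plane × Plane) × ℝ => (x.1.1, (x.1.2, x.2)) := by fun_prop
        exact (continuous_postVel.comp h1).congr fun _ => rfl
      rwa [Measure.ae_ae_comm (p := fun (p : Plane × Plane) θ => postVel p.1 p.2 θ ∉ K)
        (hm.measurable hK).compl]
  have horigin : ∀ s, 0 ≤ s → f s {0} = 0 := fun s hs => by
    refine hf.measure_eq_zero_of_isCompact hr hγ hβ isCompact_singleton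
      (fun v hv => ?_) (fun s hs => hcomm _ (measurableSet_singleton 0) s hs ?_) hs
    · rw [mem_singleton_iff.1 hv, norm_zero]; exact hr.ne
    · have := hf.isProb s hs
      filter_upwards [hθ] with θ hθ
      rw [Measure.ae_prod_iff_ae_ae (p := fun p => postVel p.1 p.2 θ ∉ ({0} : Set Plane))
        (measurable_postVel_pair θ (measurableSet_singleton 0)).compl]
      exact Eventually.of_forall fun v => ae_postVel_ne hr (hcos θ hθ) v 0
  have hprob := hf.isProb t ht
  rw [hNm.measure_eq_iSup_isCompact]
  simp only [ENNReal.iSup_eq_zero]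
  intro K hKN hK
  refine hf.measure_eq_zero_of_isCompact hr hγ hβ hK (fun v hv => hNr v (hKN hv))
    (fun s hs => hcomm K hK.measurableSet s hs ?_) ht
  have := hf.isProb s hs
  filter_upwards [hθ] with θ hθ
  exact ae_postVel_notMem_of_volume_eq_zero hr (hsin θ hθ) (hrot s) (horigin s hs)
    hK.measurableSet (measure_mono_null hKN hN)

/-! ### The time spent on the circle -/

/-- The distance to the circle of radius `r`, truncated at `1`, to the power `α`, and flattened
below `η`. -/
noncomputable def circleBarrier (r α η : ℝ) (v : Plane) : ℝ :=
  max (min |‖v‖ - r| 1) η ^ α - η ^ α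

lemma lipschitzWith_circleBarrier (r : ℝ) {α η : ℝ} (hα : α ≤ 1) (hη : 0 < η) :
    ∃ K, LipschitzWith K (circleBarrier r α η) := by
  have h1 : LipschitzWith 1 fun v : Plane => |‖v‖ - r| := by
    refine LipschitzWith.of_dist_le_mul fun x y => ?_
    rw [Real.dist_eq, NNReal.coe_one, one_mul, dist_eq_norm]
    refine (abs_abs_sub_abs_le_abs_sub _ _).trans ?_
    rw [sub_sub_sub_cancel_right]
    exact abs_norm_sub_norm_le x y
  have h2 := (lipschitzWith_max_rpow hα hη).comp (h1.min_const 1)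
  refine ⟨Real.toNNReal (|α| * η ^ (α - 1)) * 1, LipschitzWith.of_dist_le_mul fun x y => ?_⟩
  rw [circleBarrier, circleBarrier, dist_sub_right]
  exact h2.dist_le_mul x y

lemma circleBarrier_nonneg (r : ℝ) {α η : ℝ} (hα : 0 ≤ α) (hη : 0 ≤ η) (v : Plane) :
    0 ≤ circleBarrier r α η v :=
  sub_nonneg.2 (Real.rpow_le_rpow hη (le_max_right _ _) hα)

lemma circleBarrier_le_one (r : ℝ) {α η : ℝ} (hα : 0 ≤ α) (hη : 0 ≤ η) (hη1 : η ≤ 1) (v : Plane) :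
    circleBarrier r α η v ≤ 1 := by
  have h1 : max (min |‖v‖ - r| 1) η ^ α ≤ 1 :=
    Real.rpow_le_one (hη.trans (le_max_right _ _)) (max_le (min_le_right _ _) hη1) hα
  have h2 : 0 ≤ η ^ α := Real.rpow_nonneg hη α
  rw [circleBarrier]; linarith

lemma circleBarrier_le_rpow (r : ℝ) {α η : ℝ} (hα : 0 ≤ α) (hη : 0 ≤ η) (v : Plane) :
    circleBarrier r α η v ≤ |‖v‖ - r| ^ α := by
  have h2 : 0 ≤ η ^ α := Real.rpow_nonneg hη α
  have h3 : 0 ≤ |‖v‖ - r| ^ α := Real.rpow_nonneg (abs_nonneg _) α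
  rw [circleBarrier]
  rcases le_total (min |‖v‖ - r| 1) η with h | h
  · rw [max_eq_right h]; linarith
  · rw [max_eq_left h]
    have : min |‖v‖ - r| 1 ^ α ≤ |‖v‖ - r| ^ α :=
      Real.rpow_le_rpow (hη.trans h) (min_le_left _ _) hα
    linarith

lemma circleBarrier_eq_zero {r α η : ℝ} (hη : 0 ≤ η) {v : Plane} (hv : ‖v‖ = r) :
    circleBarrier r α η v = 0 := by
  rw [circleBarrier, hv, sub_self, abs_zero, min_eq_left zero_le_one, max_eq_right hη, sub_self]

lemma le_circleBarrier {r α η x : ℝ} (hα : 0 ≤ α) (hx : 0 ≤ x) {v : Plane}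
    (h : x ≤ min |‖v‖ - r| 1) : x ^ α - η ^ α ≤ circleBarrier r α η v :=
  sub_le_sub_right (Real.rpow_le_rpow hx (h.trans (le_max_left _ _)) hα) _

/-- A collision with a partner at angle `a` moves a point of the circle away from the circle by a
distance at least proportional to `a`. -/
lemma le_abs_norm_postVel_sub {r a θ s : ℝ} (hr : 0 < r) (ha : 0 ≤ a) (ha1 : a ≤ 1)
    (hθ : s ≤ |Real.sin θ|) :
    r * s / 6 * a ≤ |‖postVel !₂[r, 0] !₂[r * Real.cos a, r * Real.sin a] θ‖ - r| := by
  set N := ‖postVel !₂[r, 0] !₂[r * Real.cos a, r * Real.sin a] θ‖ with hN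
  have hN0 : 0 ≤ N := norm_nonneg _
  have h1 : N ^ 2 - r ^ 2 = r ^ 2 * (Real.sin θ * Real.sin a) := by
    rw [hN, norm_sq_postVel_axis]; ring
  have hsin : a / 2 ≤ Real.sin a := by
    have hπ := Real.pi_pos
    have hπ3 := Real.pi_gt_three
    have hπ4 := Real.pi_le_four
    have h2 := Real.mul_le_sin ha (by linarith)
    refine le_trans ?_ h2
    rw [div_eq_mul_inv, mul_comm a]
    gcongr
    rw [inv_eq_one_div, div_le_div_iff₀ two_pos hπ]; linarith
  have hprod : s * (a / 2) ≤ |Real.sin θ * Real.sin a| := by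
    rw [abs_mul]
    exact mul_le_mul hθ (hsin.trans (le_abs_self _)) (by positivity) (abs_nonneg _)
  have hle : |Real.sin θ * Real.sin a| ≤ 1 := by
    rw [abs_mul]
    exact mul_le_one₀ (Real.abs_sin_le_one θ) (abs_nonneg _) (Real.abs_sin_le_one a)
  have hN2 : N ≤ 2 * r := by
    have h3 := (abs_le.1 hle).2
    refine abs_le_of_sq_le_sq' ?_ (by positivity) |>.2
    nlinarith [sq_nonneg r]
  have h4 : |N - r| * (N + r) = r ^ 2 * |Real.sin θ * Real.sin a| := by
    rw [← abs_of_nonneg (by positivity : 0 ≤ N + r), ← abs_mul,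
      ← abs_of_nonneg (by positivity : 0 ≤ r ^ 2), ← abs_mul, ← h1]
    congr 1; ring
  have h5 : |N - r| * (N + r) ≤ |N - r| * (3 * r) := by gcongr; linarith
  have h6 : r ^ 2 * (s * (a / 2)) ≤ |N - r| * (3 * r) :=
    (mul_le_mul_of_nonneg_left hprod (sq_nonneg r)).trans (h4 ▸ h5)
  have h7 : (r * s / 6 * a) * (3 * r) ≤ |N - r| * (3 * r) := by
    refine le_trans (le_of_eq ?_) h6; ring
  exact le_of_mul_le_mul_right h7 (by positivity)

lemma norm_sub_circle_le {r a : ℝ} (hr : 0 ≤ r) (ha : 0 ≤ a) :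
    ‖(!₂[r, 0] : Plane) - !₂[r * Real.cos a, r * Real.sin a]‖ ≤ r * a := by
  rw [← sq_le_sq₀ (norm_nonneg _) (by positivity), norm_sq_plane]
  simp only [PiLp.sub_apply, Matrix.cons_val_zero, Matrix.cons_val_one, zero_sub, neg_sq]
  have h1 := Real.sin_sq_add_cos_sq a
  have h2 := Real.one_sub_sq_div_two_le_cos (x := a)
  have h3 : (r - r * Real.cos a) ^ 2 + (r * Real.sin a) ^ 2 = r ^ 2 * (2 * (1 - Real.cos a)) := by
    linear_combination r ^ 2 * h1
  rw [h3, mul_pow]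
  gcongr
  linarith

lemma exists_sin_lower_bound {β : Measure ℝ} (hβ : IsCrossSection β) (hβ₀ : VanishesNearZero β) :
    ∃ s, 0 < s ∧ ∀ᵐ θ ∂β, s ≤ |Real.sin θ| := by
  obtain ⟨θ₀, ⟨h0, h1⟩, hv⟩ := hβ₀
  have hπ := Real.pi_pos
  have hA : ∀ᵐ θ ∂β, θ ∈ Icc (-(Real.pi / 2)) (Real.pi / 2) \ {0} := hβ.carrier
  have hB : ∀ᵐ θ ∂β, θ ∉ Ioo (-θ₀) θ₀ := measure_eq_zero_iff_ae_notMem.1 hv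
  refine ⟨Real.sin θ₀, Real.sin_pos_of_pos_of_lt_pi h0 (by linarith), ?_⟩
  filter_upwards [hA, hB] with θ hθ hθ'
  have ha : θ₀ ≤ |θ| := by
    by_contra h
    exact hθ' (abs_lt.1 (not_le.1 h))
  have hb : |θ| ≤ Real.pi / 2 := abs_le.2 ⟨hθ.1.1, hθ.1.2⟩
  rw [Real.abs_sin_eq_sin_abs_of_abs_le_pi (by linarith)]
  exact Real.sin_le_sin_of_le_of_le_pi_div_two (by linarith) hb ha

/-- From a point of the circle, the gain of the barrier functions is unbounded as `η → 0`: a partner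
at angle `a` is met at rate of order `a ^ γ`, and then the barrier increases by an amount of order
`a ^ α` with `γ + α = -1`. -/
lemma exists_collision_circleBarrier_ge {r : ℝ} (hr : 0 < r) {γ : ℝ} (hγ : γ ∈ Ioo (-2 : ℝ) (-1))
    {β : Measure ℝ} (hβ : IsCrossSection β) (hβ₀ : VanishesNearZero β) (M : ℝ) :
    ∃ η, 0 < η ∧ η ≤ 1 ∧
      M ≤ ∫ w, collision γ β (circleBarrier r (-(γ + 1)) η) !₂[r, 0] w ∂(uniformCircle r) := by
  have := hβ.isFiniteMeasure
  have hb := hβ.real_univ_pos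
  obtain ⟨hγ1, hγ2⟩ := hγ
  have hπ := Real.pi_pos
  have hπ3 := Real.pi_gt_three
  set b := β.real univ with hbdef
  set α := -(γ + 1) with hα
  have hα0 : 0 < α := by linarith
  obtain ⟨s, hs, hsθ⟩ := exists_sin_lower_bound hβ hβ₀
  set κ := min (r * s / 6) 1 with hκ
  have hκ0 : 0 < κ := lt_min (by positivity) one_pos
  set c := r ^ γ * (b * (κ ^ α / 2)) with hc
  have hc0 : 0 < c := by positivity
  -- the angle from which the partners are taken into account, and the corresponding `η`
  set a₀ := Real.exp (-(2 * Real.pi * |M| / c)) with ha₀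
  have ha₀0 : 0 < a₀ := Real.exp_pos _
  have ha₀1 : a₀ ≤ 1 := Real.exp_le_one_iff.2 (neg_nonpos.2 (by positivity))
  set η := κ * a₀ * (1 / 2 : ℝ) ^ (1 / α) with hη
  have hη0 : 0 < η := by positivity
  have hη1 : η ≤ 1 := by
    refine mul_le_one₀ (mul_le_one₀ (min_le_right _ _) ha₀0.le ha₀1) (by positivity) ?_
    exact Real.rpow_le_one (by norm_num) (by norm_num) (by positivity)
  have hηα : η ^ α = (κ * a₀) ^ α / 2 := by
    rw [hη, Real.mul_rpow (by positivity) (by positivity), ← Real.rpow_mul (by norm_num),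
      one_div_mul_cancel hα0.ne', Real.rpow_one]
    ring
  refine ⟨η, hη0, hη1, ?_⟩
  set φ := circleBarrier r α η with hφ
  obtain ⟨K, hK⟩ := lipschitzWith_circleBarrier r (α := α) (by linarith) hη0
  have hφ0 : ∀ v, 0 ≤ φ v := circleBarrier_nonneg r hα0.le hη0.le
  have hφ1 : ∀ v, φ v ≤ 1 := circleBarrier_le_one r hα0.le hη0.le hη1
  have he : φ !₂[r, 0] = 0 := circleBarrier_eq_zero hη0.le (by
    have := norm_circle_param hr.le 0
    simpa using this)
  have hcoll0 : ∀ w, 0 ≤ collision γ β φ !₂[r, 0] w := fun w => by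
    rw [collision_eq hβ, he]
    simp only [sub_zero]
    exact mul_nonneg (Real.rpow_nonneg (norm_nonneg _) _) (integral_nonneg fun θ => hφ0 _)
  have hcm : Measurable fun w => collision γ β φ !₂[r, 0] w :=
    (measurable_collision hβ hK.continuous).comp (measurable_const.prodMk measurable_id)
  have hlow : ∀ a ∈ Ioc a₀ 1, c * a⁻¹ ≤
      collision γ β φ !₂[r, 0] !₂[r * Real.cos a, r * Real.sin a] := by
    intro a ha
    have ha0 : 0 < a := ha₀0.trans ha.1
    rw [collision_eq hβ, he]
    simp only [sub_zero]
    have hpc : Continuous fun θ => postVel !₂[r, 0] !₂[r * Real.cos a, r * Real.sin a] θ := by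
      have : Continuous fun θ : ℝ => ((!₂[r, 0] : Plane),
        ((!₂[r * Real.cos a, r * Real.sin a] : Plane), θ)) := by fun_prop
      exact (continuous_postVel.comp this).congr fun _ => rfl
    have h1 : b * (κ ^ α / 2 * a ^ α) ≤
        ∫ θ, φ (postVel !₂[r, 0] !₂[r * Real.cos a, r * Real.sin a] θ) ∂β := by
      have h2 : ∫ θ, (κ ^ α / 2 * a ^ α) ∂β = b * (κ ^ α / 2 * a ^ α) := by simp [hbdef]
      rw [← h2]
      refine integral_mono_ae (integrable_const _) (Integrable.of_bound
        (hK.continuous.comp hpc).aestronglyMeasurable 1 (Eventually.of_forall fun θ => by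
          rw [Real.norm_of_nonneg (hφ0 _)]; exact hφ1 _)) ?_
      filter_upwards [hsθ] with θ hθ
      have h3 : κ * a ≤ min |‖postVel !₂[r, 0] !₂[r * Real.cos a, r * Real.sin a] θ‖ - r| 1 := by
        refine le_min ?_ (mul_le_one₀ (min_le_right _ _) ha0.le ha.2)
        refine le_trans ?_ (le_abs_norm_postVel_sub hr ha0.le ha.2 hθ)
        gcongr
        exact min_le_left _ _
      refine le_trans ?_ (le_circleBarrier hα0.le (by positivity) h3)
      rw [hηα]
      have h4 : (κ * a₀) ^ α ≤ (κ * a) ^ α :=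
        Real.rpow_le_rpow (by positivity) (by gcongr; exact ha.1.le) hα0.le
      have h5 : (κ * a) ^ α = κ ^ α * a ^ α := Real.mul_rpow hκ0.le ha0.le
      linarith
    have h6 : (r * a) ^ γ ≤ ‖(!₂[r, 0] : Plane) - !₂[r * Real.cos a, r * Real.sin a]‖ ^ γ := by
      refine Real.rpow_le_rpow_of_nonpos ?_ (norm_sub_circle_le hr.le ha0.le) (by linarith)
      have := norm_axis_sub_circle_ge hr.le hr.le (a := a)
        (by rw [abs_of_pos ha0]; linarith [ha.2])
      refine lt_of_lt_of_le ?_ this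
      positivity
    calc c * a⁻¹ = (r * a) ^ γ * (b * (κ ^ α / 2 * a ^ α)) := by
          have h7 : a ^ γ * a ^ α = a⁻¹ := by
            rw [← Real.rpow_add ha0, ← Real.rpow_neg_one]; congr 1; rw [hα]; ring
          rw [Real.mul_rpow hr.le ha0.le, ← h7, hc]; ring
      _ ≤ _ := mul_le_mul h6 h1 (by positivity) (by positivity)
  have hint : Integrable (fun w => collision γ β φ !₂[r, 0] w) (uniformCircle r) := by
    obtain ⟨C, -, hC⟩ := exists_potential_bound hr (p := γ + 1) (by linarith) (by linarith)
    exact ((hC _).1.const_mul (K * β.real univ)).mono' hcm.aestronglyMeasurable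
      (Eventually.of_forall fun w => abs_collision_le hβ hK _ w)
  refine (le_abs_self M).trans ?_
  rw [← ENNReal.ofReal_le_ofReal_iff (integral_nonneg hcoll0),
    ofReal_integral_eq_lintegral_ofReal hint (Eventually.of_forall hcoll0),
    lintegral_uniformCircle r hcm.ennreal_ofReal]
  have hlog : ∫ a in Ioc a₀ 1, c * a⁻¹ = 2 * Real.pi * |M| := by
    rw [← intervalIntegral.integral_of_le ha₀1, intervalIntegral.integral_const_mul,
      integral_inv_of_pos ha₀0 one_pos, one_div, Real.log_inv, ha₀, Real.log_exp]
    field_simp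
  have hi : IntegrableOn (fun a => c * a⁻¹) (Ioc a₀ 1) := by
    have : ContinuousOn (fun a : ℝ => c * a⁻¹) (Icc a₀ 1) :=
      continuousOn_const.mul (continuousOn_id.inv₀ fun x hx => (ha₀0.trans_le hx.1).ne')
    exact (this.integrableOn_compact isCompact_Icc).mono_set Ioc_subset_Icc_self
  calc ENNReal.ofReal |M|
      = ENNReal.ofReal (1 / (2 * Real.pi)) * ENNReal.ofReal (∫ a in Ioc a₀ 1, c * a⁻¹) := by
        rw [hlog, ← ENNReal.ofReal_mul (by positivity)]
        congr 1; field_simp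
    _ = ENNReal.ofReal (1 / (2 * Real.pi)) * ∫⁻ a in Ioc a₀ 1, ENNReal.ofReal (c * a⁻¹) := by
        rw [ofReal_integral_eq_lintegral_ofReal hi]
        filter_upwards [ae_restrict_mem measurableSet_Ioc] with a ha
        have := ha₀0.trans ha.1
        simp only [Pi.zero_apply]; positivity
    _ ≤ ENNReal.ofReal (1 / (2 * Real.pi)) * ∫⁻ a in Ioc a₀ 1,
          ENNReal.ofReal (collision γ β φ !₂[r, 0] !₂[r * Real.cos a, r * Real.sin a]) := by
        refine mul_le_mul' le_rfl (lintegral_mono_ae ?_)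
        filter_upwards [ae_restrict_mem measurableSet_Ioc] with a ha
        exact ENNReal.ofReal_le_ofReal (hlow a ha)
    _ ≤ _ := by
        refine mul_le_mul' le_rfl (lintegral_mono_set fun a ha => ?_)
        exact ⟨by linarith [ha.1], by linarith [ha.2]⟩

/-- The generator is bounded below on the barrier functions, uniformly in `η`: off the circle the
loss is at most the barrier times the collision rate, that is `D ^ α * D ^ (γ + 1) = 1` up to a
constant, where `D` is the distance to the circle. -/
lemma exists_collision_circleBarrier_lower_bound {r : ℝ} (hr : 0 < r) {γ : ℝ}
    (hγ : γ ∈ Ioo (-2 : ℝ) (-1)) {β : Measure ℝ} (hβ : IsCrossSection β) :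
    ∃ B, 0 ≤ B ∧ ∀ η, 0 < η → η ≤ 1 → ∀ v : Plane, ‖v‖ ≠ r →
      -B ≤ ∫ w, collision γ β (circleBarrier r (-(γ + 1)) η) v w ∂(uniformCircle r) := by
  have := hβ.isFiniteMeasure
  obtain ⟨hγ1, hγ2⟩ := hγ
  set b := β.real univ with hbdef
  set α := -(γ + 1) with hα
  have hα0 : 0 < α := by linarith
  obtain ⟨C, hC0, hC⟩ := exists_potential_bound_off_circle hr hγ2
  refine ⟨b * C, by positivity, fun η hη hη1 v hv => ?_⟩
  obtain ⟨hi, hle⟩ := hC v hv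
  obtain ⟨K, hK⟩ := lipschitzWith_circleBarrier r (α := α) (by linarith) hη
  set φ := circleBarrier r α η with hφ
  have hφ0 : ∀ v, 0 ≤ φ v := circleBarrier_nonneg r hα0.le hη.le
  have hφ1 : ∀ v, φ v ≤ 1 := circleBarrier_le_one r hα0.le hη.le hη1
  have hcm : Measurable fun w => collision γ β φ v w :=
    (measurable_collision hβ hK.continuous).comp (measurable_const.prodMk measurable_id)
  obtain ⟨C', -, hC'⟩ := exists_potential_bound hr (p := γ + 1) (by linarith) (by linarith)
  have hint : Integrable (fun w => collision γ β φ v w) (uniformCircle r) :=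
    ((hC' v).1.const_mul (K * β.real univ)).mono' hcm.aestronglyMeasurable
      (Eventually.of_forall fun w => abs_collision_le hβ hK v w)
  have h1 : ∫ w, -(b * φ v) * ‖v - w‖ ^ γ ∂(uniformCircle r) ≤
      ∫ w, collision γ β φ v w ∂(uniformCircle r) := by
    refine integral_mono (hi.const_mul _) hint fun w => ?_
    simp only
    rw [collision_eq hβ, mul_comm]
    refine mul_le_mul_of_nonneg_left ?_ (Real.rpow_nonneg (norm_nonneg _) _)
    have hpc : Continuous fun θ => postVel v w θ := by
      have : Continuous fun θ : ℝ => (v, (w, θ)) := by fun_prop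
      exact (continuous_postVel.comp this).congr fun _ => rfl
    have h2 : ∫ θ, -φ v ∂β = -(b * φ v) := by simp [hbdef]
    rw [← h2]
    refine integral_mono (integrable_const _) ((Integrable.of_bound
      (hK.continuous.comp hpc).aestronglyMeasurable 1 (Eventually.of_forall fun θ => ?_)).sub
      (integrable_const _)) fun θ => ?_
    · rw [Function.comp_apply, Real.norm_of_nonneg (hφ0 _)]; exact hφ1 _
    · have := hφ0 (postVel v w θ)
      simp only; linarith
  refine le_trans ?_ h1
  rw [integral_const_mul, neg_mul, neg_le_neg_iff]
  have hD : 0 < |‖v‖ - r| := abs_pos.2 (sub_ne_zero.2 hv)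
  calc b * φ v * ∫ w, ‖v - w‖ ^ γ ∂(uniformCircle r)
      ≤ b * |‖v‖ - r| ^ α * (C * |‖v‖ - r| ^ (γ + 1)) := by
        refine mul_le_mul (mul_le_mul_of_nonneg_left
          (circleBarrier_le_rpow r hα0.le hη.le v) measureReal_nonneg) hle
          (integral_nonneg fun w => Real.rpow_nonneg (norm_nonneg _) _) (by positivity)
    _ = b * C * (|‖v‖ - r| ^ α * |‖v‖ - r| ^ (γ + 1)) := by ring
    _ = b * C := by
        rw [← Real.rpow_add hD, hα, neg_add_cancel, Real.rpow_zero, mul_one]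

/-- A solution spends no time on the circle. -/
lemma IsSolution.ae_measure_circle_eq_zero {r : ℝ} (hr : 0 < r) {γ : ℝ}
    (hγ : γ ∈ Ioo (-2 : ℝ) (-1)) {β : Measure ℝ} (hβ : IsCrossSection β)
    (hβ₀ : VanishesNearZero β) {f : ℝ → Measure Plane}
    (hf : IsSolution (uniformCircle r) γ β f) {T : ℝ} (hT : 0 ≤ T) :
    ∀ᵐ s ∂(volume.restrict (Ioc 0 T)), f s {v | ‖v‖ = r} = 0 := by
  have := hβ.isFiniteMeasure
  have hα0 : 0 ≤ -(γ + 1) := by linarith [hγ.2]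
  have hα1 : -(γ + 1) ≤ 1 := by linarith [hγ.1]
  obtain ⟨B, hB0, hB⟩ := exists_collision_circleBarrier_lower_bound hr hγ hβ
  choose η hη0 hη1 hηM using fun k : ℕ =>
    exists_collision_circleBarrier_ge hr hγ hβ hβ₀ ((k : ℝ) + 1)
  set φ : ℕ → Plane → ℝ := fun k => circleBarrier r (-(γ + 1)) (η k) with hφ
  have hφL : ∀ k, ∃ K, LipschitzWith K (φ k) := fun k => lipschitzWith_circleBarrier r hα1 (hη0 k)
  set G : ℕ → Plane → ℝ := fun k v => ∫ w, collision γ β (φ k) v w ∂(uniformCircle r) with hG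
  have hCm : MeasurableSet {v : Plane | ‖v‖ = r} :=
    measurableSet_eq_fun measurable_norm measurable_const
  -- on the circle, the generator does not depend on the point
  have hGcirc : ∀ (k : ℕ) v, ‖v‖ = r → (k : ℝ) + 1 ≤ G k v := fun k v hv => by
    obtain ⟨K, hK⟩ := hφL k
    obtain ⟨A, -, hi, -⟩ := exists_jumpGen_bound hr hγ (β := β) hK
    obtain ⟨ξ, hξ⟩ := exists_eq_rot v
    rw [hv] at hξ
    refine (hηM k).trans (le_of_eq ?_)
    simp only [hG]
    rw [integral_collision_eq_jumpGen hβ (hi _), integral_collision_eq_jumpGen hβ (hi _), hξ,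
      jumpGen_rot]
    congr 1
    funext x
    simp only [hφ, circleBarrier, norm_rot]
  have hGlow : ∀ (k : ℕ) v, {v : Plane | ‖v‖ = r}.indicator (fun _ => (k : ℝ) + 1) v - B ≤ G k v :=
    fun k v => by
      by_cases hv : ‖v‖ = r
      · rw [indicator_of_mem (by exact hv)]
        linarith [hGcirc k v hv]
      · rw [indicator_of_notMem (by exact hv), zero_sub]
        exact hB _ (hη0 k) (hη1 k) v hv
  set H : ℕ → ℝ → ℝ := fun k s => ∫ v, G k v ∂(f s) with hH
  have hHlow : ∀ (k : ℕ) s, 0 ≤ s → ((k : ℝ) + 1) * (f s).real {v | ‖v‖ = r} ≤ H k s + B :=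
    fun k s hs => by
      have := hf.isProb s hs
      have hGi : Integrable (G k) (f s) :=
        (hf.integrable_collision _ (hφL k) s hs).integral_prod_left
      have hI : Integrable ({v : Plane | ‖v‖ = r}.indicator fun _ => (k : ℝ) + 1) (f s) :=
        (integrable_const _).indicator hCm
      have h1 := integral_mono (hI.sub (integrable_const B)) hGi (hGlow k)
      rw [integral_sub' hI (integrable_const B), integral_indicator_const _ hCm] at h1
      simp only [integral_const, probReal_univ, smul_eq_mul, one_mul] at h1
      simp only [hH]; linarith
  have hHint : ∀ k, IntegrableOn (fun s => H k s + B) (Ioc 0 T) := fun k => by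
    have h1 := hf.integrable_time _ (hφL k) T hT
    rw [intervalIntegrable_iff_integrableOn_Ioc_of_le hT] at h1
    exact h1.add (integrable_const B)
  have hHtot : ∀ k, ∫ s in Ioc 0 T, (H k s + B) ≤ 1 + B * T := fun k => by
    have h1 := hf.integrable_time _ (hφL k) T hT
    have h2 := hf.weak_eq _ (hφL k) T hT
    have h3 : ∫ v, φ k v ∂(uniformCircle r) = 0 := by
      refine integral_eq_zero_of_ae ?_
      filter_upwards [ae_norm_uniformCircle hr.le] with v hv
      exact circleBarrier_eq_zero (hη0 k).le hv
    have h4 : ∫ v, φ k v ∂(f T) ≤ 1 := by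
      have := hf.isProb T hT
      have h5 := integral_mono (hf.integrable _ (hφL k) T hT) (integrable_const 1)
        fun v => circleBarrier_le_one r hα0 (hη0 k).le (hη1 k) v
      simpa using h5
    rw [← intervalIntegral.integral_of_le hT,
      intervalIntegral.integral_add h1 intervalIntegrable_const, intervalIntegral.integral_const,
      sub_zero, smul_eq_mul, mul_comm T]
    linarith
  -- measurable upper bounds for the mass of the circle, of arbitrarily small time integral
  set U : ℕ → ℝ → ℝ≥0∞ := fun k s => ENNReal.ofReal ((H k s + B) / ((k : ℝ) + 1)) with hU
  have hUm : ∀ k, AEMeasurable (U k) (volume.restrict (Ioc 0 T)) := fun k =>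
    ((hHint k).aestronglyMeasurable.aemeasurable.div_const _).ennreal_ofReal
  have hHnn : ∀ (k : ℕ) s, 0 ≤ s → 0 ≤ H k s + B := fun k s hs =>
    le_trans (by positivity) (hHlow k s hs)
  have hUint : ∀ k, ∫⁻ s in Ioc 0 T, U k s ≤ ENNReal.ofReal ((1 + B * T) / ((k : ℝ) + 1)) :=
    fun k => by
      rw [hU, ← ofReal_integral_eq_lintegral_ofReal ((hHint k).div_const _), integral_div]
      · refine ENNReal.ofReal_le_ofReal ?_
        gcongr
        exact hHtot k
      · filter_upwards [ae_restrict_mem measurableSet_Ioc] with s hs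
        exact div_nonneg (hHnn k s hs.1.le) (by positivity)
  have hzero : ∫⁻ s in Ioc 0 T, ⨅ k, U k s = 0 := by
    have hlim : Tendsto (fun k : ℕ => ENNReal.ofReal ((1 + B * T) / ((k : ℝ) + 1))) atTop
        (𝓝 (ENNReal.ofReal 0)) := by
      refine ENNReal.tendsto_ofReal ?_
      have := tendsto_one_div_add_atTop_nhds_zero_nat (𝕜 := ℝ) |>.const_mul (1 + B * T)
      simpa [div_eq_mul_inv] using this
    rw [ENNReal.ofReal_zero] at hlim
    refine le_antisymm (ge_of_tendsto' hlim fun k => ?_) zero_le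
    exact (lintegral_mono fun s => iInf_le _ k).trans (hUint k)
  rw [lintegral_eq_zero_iff' (AEMeasurable.iInf hUm)] at hzero
  filter_upwards [hzero, ae_restrict_mem measurableSet_Ioc] with s hs hsI
  have := hf.isProb s hsI.1.le
  refine le_antisymm ?_ zero_le
  rw [Pi.zero_apply] at hs
  rw [← hs]
  refine le_iInf fun k => ?_
  rw [← ofReal_measureReal]
  refine ENNReal.ofReal_le_ofReal ?_
  rw [le_div_iff₀ (by positivity), mul_comm]
  exact hHlow k s hsI.1.le

end LinBoltzmann


theorem theorem1 (γ : ℝ) (hγ : γ ∈ Set.Ioo (-2 : ℝ) (-1)) (β : MeasureTheory.Measure ℝ)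
    (hβ : LinBoltzmann.IsCrossSection β) (hβ₀ : LinBoltzmann.VanishesNearZero β)
    (r₀ : ℝ) (hr₀ : 0 < r₀) :
    ∃ f : ℝ → MeasureTheory.Measure LinBoltzmann.Plane,
      LinBoltzmann.IsSolution (LinBoltzmann.uniformCircle r₀) γ β f ∧
      ∀ᵐ t ∂(MeasureTheory.volume.restrict (Set.Ioi (0 : ℝ))),
        LinBoltzmann.HasLebesgueDensity (f t) := by
  obtain ⟨f, hf, hrot⟩ := LinBoltzmann.exists_radial_solution hr₀ hγ hβ hβ₀
  refine ⟨f, hf, ?_⟩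
  have h1 : ∀ᵐ t : ℝ, ∀ n : ℕ, t ∈ Ioc (0 : ℝ) n → f t {v | ‖v‖ = r₀} = 0 :=
    ae_all_iff.2 fun n => (ae_restrict_iff' measurableSet_Ioc).1
      (hf.ae_measure_circle_eq_zero hr₀ hγ hβ hβ₀ n.cast_nonneg)
  rw [ae_restrict_iff' measurableSet_Ioi]
  filter_upwards [h1] with t ht ht0
  have ht0' : 0 < t := ht0
  obtain ⟨n, hn⟩ := exists_nat_ge t
  have hC := ht n ⟨ht0', hn⟩
  have hprob := hf.isProb t ht0'.le
  have hCm : MeasurableSet {v : LinBoltzmann.Plane | ‖v‖ = r₀} :=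
    measurableSet_eq_fun measurable_norm measurable_const
  have hac : f t ≪ volume := by
    refine Measure.AbsolutelyContinuous.mk fun N hN hN0 => ?_
    have h2 : f t (N \ {v | ‖v‖ = r₀}) = 0 :=
      hf.measure_eq_zero_of_volume_eq_zero hr₀ hγ hβ hrot (hN.diff hCm)
        (measure_mono_null sdiff_subset hN0) (fun v hv => hv.2) ht0'.le
    exact measure_mono_null (fun v hv => or_iff_not_imp_right.2 fun h => ⟨hv, h⟩)
      (measure_union_null h2 hC)
  exact ⟨(f t).rnDeriv volume, Measure.measurable_rnDeriv _ _,
    (Measure.withDensity_rnDeriv_eq _ _ hac).symm⟩
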